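/- **Setting.** Let $\beta>0$ and let $p_g$ be a probability distribution on $\mathbb R$ such that, for $g\sim p_g$: $p_g$ is even, $\mathbb E[g]=0$, $\mathrm{Var}(g)=1$, $\mathbb E[\exp(g^2/2)]<\infty$, and for some constant $\Lambda>0$, $\mathbb E[h_m(g)]\le \Lambda^m m!$ for all $m\in\mathbb N$, where $h_m$ is the monic (probabilists') Hermite polynomial of degree $m$. Let $\kappa_4^g=\mathbb E[g^4]-3\,\mathbb E[g^2]^2$ be its fourth cumulant. For $n\ge 0$, $d\ge 1$ let $\mathbb Q_{n,d}$ be the law of $n$ i.i.d. $\mathcal N(0,\mathbb 1_d)$ vectors and $\mathbb P_{n,d}$ the law of $x^1,\dots,x^n\in\mathbb R^d$ given by $$x^\mu=S\Big(\sqrt{\tfrac{\beta}{d}}\,g^\mu u+z^\mu\Big),\qquad S=\mathbb 1-\frac{\beta}{1+\beta+\sqrt{1+\beta}}\,\frac{uu^\top}{d},$$ where $u$ has i.i.d. symmetric Rademacher entries, $g^\mu\sim p_g$ i.i.d., $z^\mu\sim\mathcal N(0,\mathbb 1_d)$ i.i.d., and $u,(g^\mu),(z^\mu)$ are independent. Let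 $L=d\mathbb P_{n,d}/d\mathbb Q_{n,d}$, let $L^{\le D}_{n,d}$ be the orthogonal projection of $L$ in $L^2(\mathbb Q_{n,d})$ onto the polynomials of degree at most $D$ in the $nd$ variables, and let $\|\cdot\|$ be the norm of $L^2(\mathbb Q_{n,d})$. **Theorem.** For all $n\ge0$, $d\ge1$, $\mathbb P_{n,d}\ll\mathbb Q_{n,d}$ and $L\in L^2(\mathbb Q_{n,d})$, and the following hold. 1. For all $n\ge 0$, $d\ge1$, $D\ge 0$, $$\|L^{\le D}_{n,d}\|^2\ \ge\ \sum_{m=0}^{\lfloor D/4\rfloor}\binom nm\binom{d+1}2^m\left(\frac{\beta^2\kappa_4^g}{\sqrt{4!}\,d^2(1+\beta)^2}\right)^{2m}.$$ 2. For all $n\ge0$, $d\ge1$, $D\ge0$ with $\lfloor D/4\rfloor\le n$ and $\lfloor D/2\rfloor\le d$, $$\|L^{\le D}_{n,d}\|^2\ \le\ 1+\sum_{m=1}^{D}\frac{C_m}{d^m}\,\sup_{1\le k\le m}\big(\mathbb E[h_k(g)]^2\big)^{m/k}\binom n{\lfloor m/4\rfloor}\binom d{\lfloor m/2\rfloor},\qquad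 C_m=\left(\frac\beta{1+\beta}\right)^m\binom{\lfloor m/4\rfloor\lfloor m/2\rfloor+m-1}{m}.$$ 3. Let $0<\varepsilon<1$, $\theta>0$, $D:\mathbb N\to\mathbb N$ with $D(n)\asymp\log^{1+\varepsilon}n$, and let $n,d\to\infty$ along any sequence with $n\asymp d^\theta$. Then, for all sufficiently large $n,d$ in the sequence, $$\|L^{\le D(n)}_{n,d}\|^2\ \ge\ \left(\frac1{\lfloor D(n)/4\rfloor}\Big(\frac{\beta^2\kappa_4^g}{(1+\beta)^2}\Big)^2\frac n{d^2}\right)^{\lfloor D(n)/4\rfloor},\qquad \|L^{\le D(n)}_{n,d}\|^2\ \le\ 1+\sum_{m=1}^{D(n)}\Big(\frac{\Lambda^2\beta}{1+\beta}\Big)^m m^{4m}\Big(\frac n{d^2}\Big)^{m/4}.$$ Moreover $\|L^{\le D(n)}_{n,d}\|\to1$ if $0<\theta<2$, and $\|L^{\le D(n)}_{n,d}\|\to+\infty$ if $\theta>2$ and $\kappa_4^g\neq0$. -/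

import Mathlib

open MeasureTheory ProbabilityTheory Filter Topology
open scoped ENNReal NNReal Matrix

noncomputable section

namespace SpikedCumulant

/-! ### The latent distribution -/

/-- The `k`-th Hermite coefficient `𝔼[h_k(g)]`, `g ∼ p`, for the probabilists' Hermite polynomials
(monic, orthogonal with respect to the standard Gaussian). -/
def hermiteCoeff (p : Measure ℝ) (k : ℕ) : ℝ :=
  ∫ x, Polynomial.aeval x (Polynomial.hermite k) ∂p

/-- The fourth cumulant of a centred distribution on the line. -/
def kappa4 (p : Measure ℝ) : ℝ :=
  (∫ x, x ^ 4 ∂p) - 3 * (∫ x, x ^ 2 ∂p) ^ 2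

/-- The assumption on the distribution `p` of the latent variable `g`, with constant `Λ`:
`p` is even, has mean `0` and variance `1`, its Hermite coefficients satisfy
`𝔼[h_m(g)] ≤ Λ ^ m * m!`, and `𝔼[exp(g² / 2)] < ∞`. -/
structure LatentAssumption (p : Measure ℝ) (Λ : ℝ) : Prop where
  even : p.map (fun x => -x) = p
  mean_zero : ∫ x, x ∂p = 0
  variance_one : Var[fun x => x; p] = 1
  const_pos : 0 < Λ
  hermite_le : ∀ m : ℕ, hermiteCoeff p m ≤ Λ ^ m * (m.factorial : ℝ)
  exp_integrable : Integrable (fun x : ℝ => Real.exp (x ^ 2 / 2)) p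

/-! ### The two hypotheses

A data matrix with `n` samples in dimension `d` is a function `Fin n → Fin d → ℝ`. -/

/-- The symmetric Rademacher distribution on `{-1, 1}`. -/
def rademacher : Measure ℝ :=
  (2⁻¹ : ℝ≥0∞) • Measure.dirac 1 + (2⁻¹ : ℝ≥0∞) • Measure.dirac (-1)

/-- The null hypothesis: `n` independent standard Gaussian vectors in `ℝ ^ d`. -/
def nullMeasure (n d : ℕ) : Measure (Fin n → Fin d → ℝ) :=
  Measure.pi fun _ => Measure.pi fun _ => gaussianReal 0 1

/-- The whitening matrix `S = 1 - β / (1 + β + √(1 + β)) * u uᵀ / d`. -/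
def whitening {d : ℕ} (β : ℝ) (u : Fin d → ℝ) : Matrix (Fin d) (Fin d) ℝ :=
  1 - (β / (1 + β + √(1 + β)) / (d : ℝ)) • Matrix.vecMulVec u u

/-- One sample `x = S (√(β / d) g u + z)` of the spiked cumulant model with spike `u`. -/
def spikedSample {d : ℕ} (β : ℝ) (u : Fin d → ℝ) (g : ℝ) (z : Fin d → ℝ) : Fin d → ℝ :=
  whitening β u *ᵥ ((√(β / (d : ℝ)) * g) • u + z)

/-- The alternative hypothesis: the law of `n` samples `x^μ = S (√(β / d) g^μ u + z^μ)` that share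
one spike `u` with i.i.d. Rademacher entries, where `g^μ ∼ p` and `z^μ ∼ 𝒩(0, 1_d)` are
i.i.d. over `μ`, and `u`, `g`, `z` are independent. -/
def spikedMeasure (β : ℝ) (p : Measure ℝ) (n d : ℕ) : Measure (Fin n → Fin d → ℝ) :=
  ((Measure.pi fun _ : Fin d => rademacher).prod
      ((Measure.pi fun _ : Fin n => p).prod (nullMeasure n d))).map
    fun w μ => spikedSample β w.1 (w.2.1 μ) (w.2.2 μ)

/-! ### The low-degree likelihood ratio -/

/-- The likelihood ratio `L = dP / dQ`. -/
def likelihoodRatio {Ω : Type*} [MeasurableSpace Ω] (P Q : Measure Ω) : Ω → ℝ :=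
  fun x => (P.rnDeriv Q x).toReal

/-- The (classes of) square integrable polynomial functions of total degree at most `D` in the
`n * d` entries of the data matrix, as a subspace of `L²(Q)`. -/
def polySubspace {n d : ℕ} (Q : Measure (Fin n → Fin d → ℝ)) (D : ℕ) :
    Submodule ℝ (Lp ℝ 2 Q) where
  carrier := {f | ∃ q : MvPolynomial (Fin n × Fin d) ℝ, q.totalDegree ≤ D ∧
    f =ᵐ[Q] fun x => MvPolynomial.eval (fun i => x i.1 i.2) q}
  zero_mem' := ⟨0, by simp, by
    filter_upwards [Lp.coeFn_zero ℝ 2 Q] with x hx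
    rw [hx]
    simp⟩
  add_mem' := by
    rintro f g ⟨q, hq, hf⟩ ⟨r, hr, hg⟩
    refine ⟨q + r, (MvPolynomial.totalDegree_add q r).trans (max_le hq hr), ?_⟩
    filter_upwards [Lp.coeFn_add f g, hf, hg] with x h1 h2 h3
    rw [h1]
    simp [h2, h3]
  smul_mem' := by
    rintro c f ⟨q, hq, hf⟩
    refine ⟨c • q, (MvPolynomial.totalDegree_smul_le c q).trans hq, ?_⟩
    filter_upwards [Lp.coeFn_smul c f, hf] with x h1 h2
    rw [h1]
    simp [h2]

instance polySubspace_finiteDimensional {n d : ℕ} (Q : Measure (Fin n → Fin d → ℝ)) (D : ℕ) :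
    FiniteDimensional ℝ (polySubspace Q D) := by
  let W : Submodule ℝ (MvPolynomial.restrictTotalDegree (Fin n × Fin d) ℝ D × Lp ℝ 2 Q) :=
    { carrier := {w | w.2 =ᵐ[Q] fun x => MvPolynomial.eval (fun i => x i.1 i.2) w.1.1}
      zero_mem' := by
        show ((0 : Lp ℝ 2 Q) : (Fin n → Fin d → ℝ) → ℝ) =ᵐ[Q] _
        filter_upwards [Lp.coeFn_zero ℝ 2 Q] with x hx
        rw [hx]
        simp
      add_mem' := by
        intro a b ha hb
        show ((a.2 + b.2 : Lp ℝ 2 Q) : (Fin n → Fin d → ℝ) → ℝ) =ᵐ[Q] _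
        filter_upwards [Lp.coeFn_add a.2 b.2, ha, hb] with x h1 h2 h3
        rw [h1]
        simp [h2, h3]
      smul_mem' := by
        intro c a ha
        show ((c • a.2 : Lp ℝ 2 Q) : (Fin n → Fin d → ℝ) → ℝ) =ᵐ[Q] _
        filter_upwards [Lp.coeFn_smul c a.2, ha] with x h1 h2
        rw [h1]
        simp [h2] }
  have hinj : Function.Injective ((LinearMap.fst ℝ _ _).comp W.subtype) := by
    rintro ⟨a, ha⟩ ⟨b, hb⟩ hab
    have h1 : a.1 = b.1 := hab
    have h2 : a.2 = b.2 := by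
      apply Lp.ext
      have ha' : a.2 =ᵐ[Q] fun x => MvPolynomial.eval (fun i => x i.1 i.2) a.1.1 := ha
      have hb' : b.2 =ᵐ[Q] fun x => MvPolynomial.eval (fun i => x i.1 i.2) b.1.1 := hb
      rw [← h1] at hb'
      exact ha'.trans hb'.symm
    exact Subtype.ext (Prod.ext h1 h2)
  have hW : Module.Finite ℝ W := Module.Finite.of_injective _ hinj
  have hmap : polySubspace Q D = W.map (LinearMap.snd ℝ _ _) := by
    ext f
    constructor
    · rintro ⟨q, hq, hf⟩
      exact ⟨(⟨q, (MvPolynomial.mem_restrictTotalDegree _ _ _).2 hq⟩, f), hf, rfl⟩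
    · rintro ⟨w, hw, rfl⟩
      exact ⟨w.1.1, (MvPolynomial.mem_restrictTotalDegree _ _ _).1 w.1.2, hw⟩
  rw [hmap]
  infer_instance

instance polySubspace_hasOrthogonalProjection {n d : ℕ} (Q : Measure (Fin n → Fin d → ℝ))
    (D : ℕ) : (polySubspace Q D).HasOrthogonalProjection :=
  haveI : CompleteSpace (polySubspace Q D) := FiniteDimensional.complete ℝ _
  Submodule.HasOrthogonalProjection.ofCompleteSpace _

open Classical in
/-- The low-degree likelihood ratio `L^{≤ D}`: the orthogonal projection in `L²(Q)` of the
likelihood ratio `dP / dQ` onto the polynomials of degree at most `D`. It is meaningful when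
`P ≪ Q` and `dP / dQ ∈ L²(Q)`; the value is `0` when `dP / dQ ∉ L²(Q)`. -/
def ldlr {n d : ℕ} (P Q : Measure (Fin n → Fin d → ℝ)) (D : ℕ) : Lp ℝ 2 Q :=
  (polySubspace Q D).starProjection
    (if h : MemLp (likelihoodRatio P Q) 2 Q then h.toLp (likelihoodRatio P Q) else 0)

/-- The norm `‖L_{n,d}^{≤ D}‖` in `L²(Q)` for the spiked cumulant model. -/
def ldlrNorm (β : ℝ) (p : Measure ℝ) (n d D : ℕ) : ℝ :=
  ‖ldlr (spikedMeasure β p n d) (nullMeasure n d) D‖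

/-- The coefficient `C_m = (β / (1 + β)) ^ m * binom (⌊m/4⌋ ⌊m/2⌋ + m - 1, m)`,
for `m ≥ 1`. -/
def upperCoeff (β : ℝ) (m : ℕ) : ℝ :=
  (β / (1 + β)) ^ m * ((m / 4 * (m / 2) + m - 1).choose m : ℝ)

/-- The supremum over `1 ≤ k ≤ m` of `𝔼[h_k(g)] ^ (2 m / k)`, read as `(𝔼[h_k(g)]²) ^ (m / k)`;
used for `m ≥ 1`. -/
def hermiteSup (p : Measure ℝ) (m : ℕ) : ℝ :=
  ⨆ k : Set.Icc 1 m, (hermiteCoeff p (k : ℕ) ^ 2) ^ ((m : ℝ) / ((k : ℕ) : ℝ))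

end SpikedCumulant

end

/-! Products of Hermite polynomials `h_α` in the `n * d` entries are orthogonal under the null law,
have squared norm `α!`, and span the polynomials of bounded degree. Hence `‖L^{≤ D}‖²` is the sum
over `|α| ≤ D` of `𝔼_P[h_α]² / α!` (`norm_sq_ldlr`).

Given `u` and `g`, whitening makes a sample Gaussian with mean `a g w` and covariance `1 - a² w wᵀ`,
where `w = u / √d` and `a² = β / (1 + β)`. For this mean and covariance the Hermite moment collapses
to `a^|α| h_{|α|}(g) w^α` (`integral_prod_he_gaussian`). Averaging over `g` gives Hermite
coefficients at the row sums of `α`; averaging over `u` gives the indicator that all column sums are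
even. By the multinomial theorem the degree `m` part of the norm then factorizes (`norm_sq_eq`): it
is `𝔼[(∑ u i)^m] / d^m` times a sum over compositions of `m` into row sums `k μ`, with weights `(β /
(1 + β))^k 𝔼[h_k(g)]² / k!`.

Symmetry and unit variance kill the coefficients of order 1, 2, 3, and the fourth is the cumulant.
So at most `m / 4` rows and `m / 2` columns are active, which gives the upper bounds
(`compositionSum_le`, `degreeTerm_le`). Keeping only arrays whose active rows have sum four gives
the lower bounds (`degreeTerm_four_mul_ge`).

Square integrability follows from a stronger fact: the planted law is dominated by a finite multiple
of the null law (`spikedMeasure_le`), because the squared length of a sample exceeds that of its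
noise by at most `g²`.

In the low-degree regime the lower bound uses only the term of degree `4 ⌊D/4⌋`. For the upper
bound, integrability of `exp(g² / 2)` controls the Hermite coefficients and bounds the degree `m`
term by `(K m³ σ)^m` with `σ = (n / d²)^{1/4}`; the spare factor `m` in the target `(c m⁴ σ)^m`
allows any constant `c > 0` (`exists_sum_le_sum`). The limits follow since `D` is polylogarithmic in
`n`. -/

noncomputable section

namespace SpikedCumulant

/-! ### Hermite polynomials as real functions -/

/-- The `k`-th probabilists' Hermite polynomial, as a function on the line. -/
def he (k : ℕ) (x : ℝ) : ℝ := Polynomial.aeval x (Polynomial.hermite k)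

theorem derivative_hermite_succ (k : ℕ) :
    Polynomial.derivative (Polynomial.hermite (k + 1))
      = ((k + 1 : ℕ) : Polynomial ℤ) * Polynomial.hermite k := by
  induction k with
  | zero => simp
  | succ k ih =>
    rw [Polynomial.hermite_succ (k + 1), Polynomial.derivative_sub, Polynomial.derivative_mul, ih,
      Polynomial.derivative_mul, Polynomial.derivative_natCast, Polynomial.derivative_X,
      Polynomial.hermite_succ k]
    push_cast
    ring

@[simp] theorem he_zero (x : ℝ) : he 0 x = 1 := by simp [he]

@[simp] theorem he_one (x : ℝ) : he 1 x = x := by simp [he]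

/-- At `k = 0` the truncated index `k - 1` is harmless, its coefficient being zero. -/
theorem he_succ (k : ℕ) (x : ℝ) : he (k + 1) x = x * he k x - k * he (k - 1) x := by
  cases k with
  | zero => simp
  | succ k =>
    rw [he, Polynomial.hermite_succ (k + 1), derivative_hermite_succ]
    simp [he]

theorem he_neg (k : ℕ) (x : ℝ) : he k (-x) = (-1) ^ k * he k x := by
  induction k using Nat.strong_induction_on with
  | _ k ih =>
    match k with
    | 0 => simp
    | 1 => simp
    | k + 2 =>
      rw [he_succ, he_succ (k + 1), ih (k + 1) (by omega), ih (k + 1 - 1) (by omega)]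
      simp only [Nat.add_sub_cancel]
      ring

theorem measurable_he (k : ℕ) : Measurable (he k) := by
  unfold he
  exact (Polynomial.continuous_aeval _).measurable

/-- The shape `(|x| + s)^k` is stable under the three-term recurrence as soon as `s²` dominates the
index, since `|x| (|x| + s) + s² ≤ (|x| + s)²`. -/
theorem abs_he_le (k : ℕ) (x : ℝ) : |he k x| ≤ (|x| + √k) ^ k := by
  induction k using Nat.strong_induction_on with
  | _ k ih =>
    match k with
    | 0 => simp
    | 1 => simp
    | k + 2 =>
      set s := √((k + 2 : ℕ) : ℝ) with hs
      have hs2 : s ^ 2 = k + 2 := by rw [hs, Real.sq_sqrt (by positivity)]; push_cast; ring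
      have hs0 : 0 ≤ s := Real.sqrt_nonneg _
      have hx := abs_nonneg x
      have h1 : |he (k + 1) x| ≤ (|x| + s) ^ (k + 1) := by
        refine (ih (k + 1) (by omega)).trans ?_
        gcongr
        exact Real.sqrt_le_sqrt (by push_cast; linarith)
      have h0 : |he k x| ≤ (|x| + s) ^ k := by
        refine (ih k (by omega)).trans ?_
        gcongr
        exact Real.sqrt_le_sqrt (by push_cast; linarith)
      rw [he_succ]
      simp only [Nat.add_sub_cancel]
      calc |x * he (k + 1) x - ((k + 1 : ℕ) : ℝ) * he k x|
          ≤ |x| * |he (k + 1) x| + ((k + 1 : ℕ) : ℝ) * |he k x| := by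
            refine (abs_sub _ _).trans ?_
            rw [abs_mul, abs_mul, Nat.abs_cast]
        _ ≤ |x| * (|x| + s) ^ (k + 1) + s ^ 2 * (|x| + s) ^ k := by
            gcongr
            rw [hs2]; push_cast; linarith
        _ = (|x| + s) ^ k * (|x| * (|x| + s) + s ^ 2) := by ring
        _ ≤ (|x| + s) ^ k * ((|x| + s) ^ 2) := by
            gcongr
            nlinarith
        _ = (|x| + s) ^ (k + 2) := by ring

/-- Raise `(|x| + √k)² ≤ 2k (x²/k + 1) ≤ 2k exp(x²/k)` to the power `k`. The exponent is exactly
`x²`, so that `|he k|` is integrable whenever `exp(x² / 2)` is. -/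
theorem sq_he_le (k : ℕ) (x : ℝ) : he k x ^ 2 ≤ (2 * k) ^ k * Real.exp (x ^ 2) := by
  rcases Nat.eq_zero_or_pos k with rfl | hk
  · simpa using sq_nonneg x
  have hk' : (0 : ℝ) < k := by exact_mod_cast hk
  have hs : √(k : ℝ) ^ 2 = k := Real.sq_sqrt hk'.le
  calc he k x ^ 2 = |he k x| ^ 2 := (sq_abs _).symm
    _ ≤ ((|x| + √k) ^ k) ^ 2 := by gcongr; exact abs_he_le k x
    _ = ((|x| + √k) ^ 2) ^ k := by rw [← pow_mul, ← pow_mul, mul_comm]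
    _ ≤ (2 * k * Real.exp (x ^ 2 / k)) ^ k := by
        gcongr
        have h1 : x ^ 2 / k + 1 ≤ Real.exp (x ^ 2 / k) := Real.add_one_le_exp _
        have h2 : (2 : ℝ) * k * (x ^ 2 / k + 1) = 2 * x ^ 2 + 2 * k := by field_simp
        have h3 := mul_le_mul_of_nonneg_left h1 (by positivity : (0 : ℝ) ≤ 2 * k)
        have h4 : |x| ^ 2 = x ^ 2 := sq_abs x
        nlinarith [sq_nonneg (|x| - √k)]
    _ = (2 * k) ^ k * Real.exp (x ^ 2) := by
        rw [mul_pow, ← Real.exp_nat_mul]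
        congr 2
        field_simp

theorem abs_he_le_exp (k : ℕ) (x : ℝ) :
    |he k x| ≤ √((2 * k : ℝ) ^ k) * Real.exp (x ^ 2 / 2) := by
  refine abs_le_of_sq_le_sq ?_ (by positivity)
  rw [mul_pow, Real.sq_sqrt (by positivity), ← Real.exp_nat_mul]
  refine (sq_he_le k x).trans_eq ?_
  congr 2
  push_cast
  ring

/-! ### Integration of polynomials against the standard Gaussian -/

theorem integrable_pow_gaussian (k : ℕ) : Integrable (fun x : ℝ => x ^ k) (gaussianReal 0 1) := by
  have h := (memLp_id_gaussianReal (μ := 0) (v := 1) (k : ℝ≥0)).integrable_norm_pow'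
  simp only [id, Real.norm_eq_abs] at h
  refine (integrable_norm_iff (by fun_prop)).1 ?_
  simpa [abs_pow] using h

theorem integrable_polynomial_gaussian (q : Polynomial ℝ) :
    Integrable (fun x => q.eval x) (gaussianReal 0 1) := by
  simp only [Polynomial.eval_eq_sum_range]
  exact integrable_finsetSum _ fun i _ => (integrable_pow_gaussian i).const_mul _

/-- Integration by parts, the Gaussian density `φ` satisfying `x φ = -φ'`. -/
theorem integral_pow_succ_gaussian (k : ℕ) :
    ∫ x, x ^ (k + 1) ∂(gaussianReal 0 1) = k * ∫ x, x ^ (k - 1) ∂(gaussianReal 0 1) := by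
  have hI : ∀ j : ℕ, Integrable (fun x : ℝ => gaussianPDFReal 0 1 x * x ^ j) := by
    intro j
    have h := integrable_pow_gaussian j
    rw [gaussianReal_of_var_ne_zero _ one_ne_zero,
      integrable_withDensity_iff_integrable_smul₀' (by fun_prop)
        (by simp [gaussianPDF_lt_top])] at h
    simpa [toReal_gaussianPDF] using h
  have hd : ∀ x : ℝ, HasDerivAt (fun x => -gaussianPDFReal 0 1 x) (x * gaussianPDFReal 0 1 x) x := by
    intro x
    have h1 : HasDerivAt (fun x : ℝ => -(x - 0) ^ 2 / (2 * ((1 : ℝ≥0) : ℝ))) (-x) x := by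
      have := ((((hasDerivAt_id x).sub_const 0).pow 2).neg).div_const (2 * ((1 : ℝ≥0) : ℝ))
      refine this.congr_deriv ?_
      simp
      ring
    have h2 := ((h1.exp).const_mul (√(2 * Real.pi * ((1 : ℝ≥0) : ℝ)))⁻¹).neg
    unfold gaussianPDFReal
    refine h2.congr_deriv ?_
    ring
  have hp : ∀ x : ℝ, HasDerivAt (fun x : ℝ => x ^ k) (k * x ^ (k - 1)) x := fun x => by
    simpa using hasDerivAt_pow k x
  have key := integral_mul_deriv_eq_deriv_mul_of_integrable (u := fun x : ℝ => x ^ k)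
    (v := fun x => -gaussianPDFReal 0 1 x) (u' := fun x => k * x ^ (k - 1))
    (v' := fun x => x * gaussianPDFReal 0 1 x) (fun x _ => hp x) (fun x _ => hd x)
    ((hI (k + 1)).congr (.of_forall fun x => by simp only [Pi.mul_apply]; ring))
    (((hI (k - 1)).const_mul (-(k : ℝ))).congr
      (.of_forall fun x => by simp only [Pi.mul_apply]; ring))
    (((hI k).const_mul (-1)).congr (.of_forall fun x => by simp only [Pi.mul_apply]; ring))
  rw [integral_gaussianReal_eq_integral_smul one_ne_zero,
    integral_gaussianReal_eq_integral_smul one_ne_zero, ← integral_const_mul]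
  simp only [smul_eq_mul]
  calc ∫ x, gaussianPDFReal 0 1 x * x ^ (k + 1)
      = ∫ x, x ^ k * (x * gaussianPDFReal 0 1 x) := by
        refine integral_congr_ae (.of_forall fun x => ?_)
        simp only []; ring
    _ = ∫ x, -(k * x ^ (k - 1) * -gaussianPDFReal 0 1 x) := by rw [key, ← integral_neg]
    _ = ∫ x, k * (gaussianPDFReal 0 1 x * x ^ (k - 1)) := by
        refine integral_congr_ae (.of_forall fun x => ?_)
        simp only []; ring

/-- Gaussian integration by parts for polynomials in one variable. -/
theorem integral_mul_polynomial_gaussian (q : Polynomial ℝ) :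
    ∫ x, x * q.eval x ∂(gaussianReal 0 1) = ∫ x, q.derivative.eval x ∂(gaussianReal 0 1) := by
  induction q using Polynomial.induction_on' with
  | add p q hp hq =>
    have h : ∀ r : Polynomial ℝ, Integrable (fun x => x * r.eval x) (gaussianReal 0 1) := fun r =>
      (integrable_polynomial_gaussian (Polynomial.X * r)).congr (.of_forall fun x => by simp)
    simp only [Polynomial.eval_add, mul_add, Polynomial.derivative_add]
    rw [integral_add (h p) (h q), hp, hq, integral_add (integrable_polynomial_gaussian _)
      (integrable_polynomial_gaussian _)]
  | monomial k c =>
    simp only [Polynomial.eval_monomial, Polynomial.derivative_monomial]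
    have h1 : ∀ x : ℝ, x * (c * x ^ k) = c * x ^ (k + 1) := fun x => by ring
    simp only [h1]
    rw [integral_const_mul, integral_const_mul, integral_pow_succ_gaussian]
    ring

/-- The Hermite polynomials with real coefficients. -/
def hePoly (k : ℕ) : Polynomial ℝ := (Polynomial.hermite k).map (algebraMap ℤ ℝ)

theorem eval_hePoly (k : ℕ) (x : ℝ) : (hePoly k).eval x = he k x := by
  rw [hePoly, Polynomial.eval_map_algebraMap, he]

theorem derivative_hePoly (k : ℕ) :
    Polynomial.derivative (hePoly k) = Polynomial.C (k : ℝ) * hePoly (k - 1) := by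
  cases k with
  | zero => simp [hePoly]
  | succ k =>
    rw [hePoly, Polynomial.derivative_map, derivative_hermite_succ]
    simp [hePoly]

theorem integrable_he_mul_he (j k : ℕ) :
    Integrable (fun x => he j x * he k x) (gaussianReal 0 1) := by
  simpa [eval_hePoly] using integrable_polynomial_gaussian (hePoly j * hePoly k)

/-- Differentiating the product `he k * he j` yields two terms; the one with `he (k - 1)` cancels
the subtracted term of the recurrence for `he (k + 1)`. Iterating lowers both indices and gives
orthogonality. -/
theorem integral_he_succ_mul (j k : ℕ) :
    ∫ x, he (k + 1) x * he j x ∂(gaussianReal 0 1)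
      = j * ∫ x, he k x * he (j - 1) x ∂(gaussianReal 0 1) := by
  have h := integral_mul_polynomial_gaussian (hePoly k * hePoly j)
  simp only [Polynomial.derivative_mul, derivative_hePoly, Polynomial.eval_mul, Polynomial.eval_add,
    Polynomial.eval_C, eval_hePoly] at h
  have i1 : Integrable (fun x => x * (he k x * he j x)) (gaussianReal 0 1) :=
    (integrable_polynomial_gaussian (Polynomial.X * (hePoly k * hePoly j))).congr
      (.of_forall fun x => by simp [eval_hePoly])
  have i2 : Integrable (fun x => (k : ℝ) * he (k - 1) x * he j x) (gaussianReal 0 1) := by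
    simpa [mul_assoc] using (integrable_he_mul_he (k - 1) j).const_mul (k : ℝ)
  have i3 : Integrable (fun x => he k x * ((j : ℝ) * he (j - 1) x)) (gaussianReal 0 1) := by
    refine ((integrable_he_mul_he k (j - 1)).const_mul (j : ℝ)).congr (.of_forall fun x => ?_)
    simp only []; ring
  rw [integral_add i2 i3] at h
  have e : ∀ x, he (k + 1) x * he j x = x * (he k x * he j x) - (k : ℝ) * he (k - 1) x * he j x :=
    fun x => by rw [he_succ]; ring
  simp only [e]
  rw [integral_sub i1 i2, h, add_sub_cancel_left, ← integral_const_mul]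
  congr 1; ext x; ring

theorem integral_he_mul_he (j k : ℕ) :
    ∫ x, he j x * he k x ∂(gaussianReal 0 1) = if j = k then (j.factorial : ℝ) else 0 := by
  induction j generalizing k with
  | zero =>
    cases k with
    | zero => simp
    | succ k =>
      have := integral_he_succ_mul 0 k
      simp only [he_zero, mul_one, Nat.cast_zero, zero_mul] at this
      simp [this]
  | succ j ih =>
    rw [integral_he_succ_mul]
    cases k with
    | zero => simp
    | succ k =>
      rw [Nat.add_sub_cancel, ih]
      by_cases h : j = k
      · subst h; simp [Nat.factorial_succ]
      · simp [h]

set_option linter.unusedSectionVars false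

/-! ### Gaussian integration by parts in several variables -/

section Stein

variable {ι : Type*} [Fintype ι] [DecidableEq ι]

theorem eval_monomial_eq_prod (s : ι →₀ ℕ) (c : ℝ) (z : ι → ℝ) :
    MvPolynomial.eval z (MvPolynomial.monomial s c) = c * ∏ i, z i ^ s i := by
  rw [MvPolynomial.eval_monomial, Finsupp.prod_fintype _ _ (fun i => pow_zero _)]

theorem integrable_mvPolynomial_gaussian (q : MvPolynomial ι ℝ) :
    Integrable (fun z => MvPolynomial.eval z q) (Measure.pi fun _ : ι => gaussianReal 0 1) := by
  induction q using MvPolynomial.induction_on' with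
  | monomial s c =>
    simp only [eval_monomial_eq_prod]
    exact (Integrable.fintype_prod (f := fun i x => x ^ s i)
      fun i => integrable_pow_gaussian (s i)).const_mul c
  | add p q hp hq =>
    simp only [map_add]
    exact hp.add hq

theorem integral_mul_mvPolynomial_gaussian (l : ι) (q : MvPolynomial ι ℝ) :
    ∫ z, z l * MvPolynomial.eval z q ∂(Measure.pi fun _ : ι => gaussianReal 0 1)
      = ∫ z, MvPolynomial.eval z (MvPolynomial.pderiv l q)
          ∂(Measure.pi fun _ : ι => gaussianReal 0 1) := by
  induction q using MvPolynomial.induction_on' with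
  | monomial s c =>
    have h1 : ∀ z : ι → ℝ, z l * (c * ∏ i, z i ^ s i)
        = c * ∏ i, z i ^ (if i = l then s i + 1 else s i) := fun z => by
      rw [← Finset.mul_prod_erase Finset.univ _ (Finset.mem_univ l),
        ← Finset.mul_prod_erase Finset.univ (fun i => z i ^ (if i = l then s i + 1 else s i))
          (Finset.mem_univ l), if_pos rfl,
        Finset.prod_congr rfl (f := fun i => z i ^ (if i = l then s i + 1 else s i))
          (g := fun i => z i ^ s i) fun i hi => by rw [if_neg (Finset.ne_of_mem_erase hi)]]
      ring
    simp only [MvPolynomial.pderiv_monomial, eval_monomial_eq_prod, h1]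
    rw [integral_const_mul, integral_const_mul,
      integral_fintype_prod_eq_prod (fun i x => x ^ (if i = l then s i + 1 else s i)),
      integral_fintype_prod_eq_prod (fun i x => x ^ ((s - Finsupp.single l 1 : ι →₀ ℕ) i)),
      ← Finset.mul_prod_erase Finset.univ _ (Finset.mem_univ l),
      ← Finset.mul_prod_erase Finset.univ
        (fun i => ∫ x, x ^ ((s - Finsupp.single l 1 : ι →₀ ℕ) i) ∂(gaussianReal 0 1))
        (Finset.mem_univ l), if_pos rfl, integral_pow_succ_gaussian]
    have h2 : ∀ i ∈ Finset.univ.erase l,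
        (∫ x, x ^ (if i = l then s i + 1 else s i) ∂(gaussianReal 0 1))
          = ∫ x, x ^ ((s - Finsupp.single l 1 : ι →₀ ℕ) i) ∂(gaussianReal 0 1) := fun i hi => by
      have := Finset.ne_of_mem_erase hi
      rw [if_neg this]
      simp [this.symm]
    rw [Finset.prod_congr rfl h2]
    simp only [Finsupp.tsub_apply, Finsupp.single_eq_same]
    ring
  | add p q hp hq =>
    have h : ∀ r : MvPolynomial ι ℝ, Integrable (fun z => z l * MvPolynomial.eval z r)
        (Measure.pi fun _ : ι => gaussianReal 0 1) := fun r =>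
      (integrable_mvPolynomial_gaussian (MvPolynomial.X l * r)).congr (.of_forall fun x => by simp)
    simp only [map_add, mul_add]
    rw [integral_add (h p) (h q), hp, hq, integral_add (integrable_mvPolynomial_gaussian _)
      (integrable_mvPolynomial_gaussian _)]

end Stein

/-! ### Hermite moments of a Gaussian vector with a rank one covariance defect -/

section HermiteMoment

variable {ι : Type*} [Fintype ι] [DecidableEq ι]

/-- The affine form `v i + ∑ l, S i l * X l`. -/
def affineForm (S : Matrix ι ι ℝ) (v : ι → ℝ) (i : ι) : MvPolynomial ι ℝ :=
  MvPolynomial.C (v i) + ∑ l, MvPolynomial.C (S i l) * MvPolynomial.X l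

/-- The product of the Hermite polynomials `h_{α i}` at the affine forms. -/
def hermiteAffine (S : Matrix ι ι ℝ) (v : ι → ℝ) (α : ι → ℕ) : MvPolynomial ι ℝ :=
  ∏ i, Polynomial.aeval (affineForm S v i) (hePoly (α i))

theorem eval_affineForm (S : Matrix ι ι ℝ) (v z : ι → ℝ) (i : ι) :
    MvPolynomial.eval z (affineForm S v i) = (v + S *ᵥ z) i := by
  simp [affineForm, Matrix.mulVec, dotProduct]

theorem eval_aeval_hePoly (q : MvPolynomial ι ℝ) (k : ℕ) (z : ι → ℝ) :
    MvPolynomial.eval z (Polynomial.aeval q (hePoly k)) = he k (MvPolynomial.eval z q) := by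
  have := Polynomial.aeval_algHom_apply (MvPolynomial.aeval z : MvPolynomial ι ℝ →ₐ[ℝ] ℝ) q (hePoly k)
  rw [← MvPolynomial.coe_aeval_eq_eval, RingHom.coe_coe, ← this, ← eval_hePoly]
  simp

theorem eval_hermiteAffine (S : Matrix ι ι ℝ) (v z : ι → ℝ) (α : ι → ℕ) :
    MvPolynomial.eval z (hermiteAffine S v α) = ∏ i, he (α i) ((v + S *ᵥ z) i) := by
  simp only [hermiteAffine, map_prod, eval_aeval_hePoly, eval_affineForm]

theorem pderiv_affineForm (S : Matrix ι ι ℝ) (v : ι → ℝ) (i l : ι) :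
    MvPolynomial.pderiv l (affineForm S v i) = MvPolynomial.C (S i l) := by
  simp [affineForm, MvPolynomial.pderiv_X, Pi.single_apply]

theorem hermiteAffine_update (S : Matrix ι ι ℝ) (v : ι → ℝ) (α : ι → ℕ) (j : ι) (k : ℕ) :
    hermiteAffine S v (Function.update α j k)
      = (∏ i ∈ Finset.univ.erase j, Polynomial.aeval (affineForm S v i) (hePoly (α i)))
        * Polynomial.aeval (affineForm S v j) (hePoly k) := by
  rw [hermiteAffine, ← Finset.prod_erase_mul _ _ (Finset.mem_univ j), Function.update_self]
  congr 1
  exact Finset.prod_congr rfl fun i hi => by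
    rw [Function.update_of_ne (Finset.ne_of_mem_erase hi)]

theorem derivation_prod {κ R A : Type*} [DecidableEq κ] [CommSemiring R] [CommSemiring A]
    [Algebra R A] (D : Derivation R A A) (s : Finset κ) (f : κ → A) :
    D (∏ i ∈ s, f i) = ∑ i ∈ s, (∏ j ∈ s.erase i, f j) * D (f i) := by
  induction s using Finset.induction_on with
  | empty => simp
  | insert a s ha ih =>
    rw [Finset.prod_insert ha, Derivation.leibniz, ih, Finset.sum_insert ha,
      Finset.erase_insert ha, add_comm, smul_eq_mul, smul_eq_mul, Finset.mul_sum]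
    congr 1
    refine Finset.sum_congr rfl fun i hi => ?_
    have hne : a ≠ i := fun h => ha (h ▸ hi)
    rw [Finset.erase_insert_of_ne hne, Finset.prod_insert (by simp [ha]), mul_assoc]

theorem pderiv_hermiteAffine (S : Matrix ι ι ℝ) (v : ι → ℝ) (α : ι → ℕ) (l : ι) :
    MvPolynomial.pderiv l (hermiteAffine S v α)
      = ∑ j, MvPolynomial.C (α j * S j l)
          * hermiteAffine S v (Function.update α j (α j - 1)) := by
  simp only [hermiteAffine_update]
  rw [hermiteAffine, derivation_prod]
  refine Finset.sum_congr rfl fun j _ => ?_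
  rw [Derivation.map_aeval, derivative_hePoly, pderiv_affineForm]
  simp only [map_mul, Polynomial.aeval_C, smul_eq_mul, MvPolynomial.algebraMap_eq]
  ring

theorem hermiteAffine_succ (S : Matrix ι ι ℝ) (v : ι → ℝ) (α : ι → ℕ) (i : ι) :
    hermiteAffine S v (Function.update α i (α i + 1))
      = affineForm S v i * hermiteAffine S v α
        - MvPolynomial.C (α i : ℝ) * hermiteAffine S v (Function.update α i (α i - 1)) := by
  have h : hePoly (α i + 1)
      = Polynomial.X * hePoly (α i) - Polynomial.C (α i : ℝ) * hePoly (α i - 1) := by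
    refine Polynomial.funext fun x => ?_
    simp [eval_hePoly, he_succ]
  conv_rhs => rw [← Function.update_eq_self i α]
  simp only [hermiteAffine_update, h, map_sub, map_mul, Polynomial.aeval_X, Polynomial.aeval_C,
    Function.update_idem, Function.update_self, MvPolynomial.algebraMap_eq]
  ring

/-- Gaussian integration by parts produces the covariance `S Sᵀ`, and the Hermite recurrence
subtracts the identity, so only the covariance defect enters. -/
theorem integral_hermiteAffine_succ (S : Matrix ι ι ℝ) (v : ι → ℝ) (α : ι → ℕ) (i : ι) :
    ∫ z, MvPolynomial.eval z (hermiteAffine S v (Function.update α i (α i + 1)))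
        ∂(Measure.pi fun _ : ι => gaussianReal 0 1)
      = v i * (∫ z, MvPolynomial.eval z (hermiteAffine S v α)
          ∂(Measure.pi fun _ : ι => gaussianReal 0 1))
        + ∑ j, α j * ((S * Sᵀ - 1) i j)
          * ∫ z, MvPolynomial.eval z (hermiteAffine S v (Function.update α j (α j - 1)))
            ∂(Measure.pi fun _ : ι => gaussianReal 0 1) := by
  have hI := integrable_mvPolynomial_gaussian (ι := ι)
  have hX : ∀ (l : ι) (q : MvPolynomial ι ℝ), Integrable (fun z => z l * MvPolynomial.eval z q)
      (Measure.pi fun _ : ι => gaussianReal 0 1) := fun l r =>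
    (hI (MvPolynomial.X l * r)).congr (.of_forall fun x => by simp)
  have e : ∀ z, MvPolynomial.eval z (hermiteAffine S v (Function.update α i (α i + 1)))
      = (v i * MvPolynomial.eval z (hermiteAffine S v α)
        + ∑ l, S i l * (z l * MvPolynomial.eval z (hermiteAffine S v α)))
        - α i * MvPolynomial.eval z (hermiteAffine S v (Function.update α i (α i - 1))) := by
    intro z
    rw [hermiteAffine_succ]
    simp only [affineForm, map_sub, map_mul, map_add, MvPolynomial.eval_C, map_sum,
      MvPolynomial.eval_X, add_mul, Finset.sum_mul, mul_assoc]
  simp only [e]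
  have hS : Integrable (fun z => ∑ l, S i l * (z l * MvPolynomial.eval z (hermiteAffine S v α)))
      (Measure.pi fun _ : ι => gaussianReal 0 1) :=
    integrable_finsetSum _ fun l _ => (hX l _).const_mul _
  have hA : Integrable (fun z => v i * MvPolynomial.eval z (hermiteAffine S v α)
      + ∑ l, S i l * (z l * MvPolynomial.eval z (hermiteAffine S v α)))
      (Measure.pi fun _ : ι => gaussianReal 0 1) := ((hI _).const_mul _).add hS
  rw [integral_sub hA ((hI _).const_mul _),
    integral_add ((hI _).const_mul _) hS, integral_finsetSum _ fun l _ => (hX l _).const_mul _]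
  simp only [integral_const_mul, integral_mul_mvPolynomial_gaussian, pderiv_hermiteAffine, map_sum,
    map_mul, MvPolynomial.eval_C]
  have h2 : ∀ l, ∫ z, ∑ j, (α j * S j l) * MvPolynomial.eval z
        (hermiteAffine S v (Function.update α j (α j - 1)))
          ∂(Measure.pi fun _ : ι => gaussianReal 0 1)
      = ∑ j, (α j * S j l) * ∫ z, MvPolynomial.eval z
        (hermiteAffine S v (Function.update α j (α j - 1)))
          ∂(Measure.pi fun _ : ι => gaussianReal 0 1) := fun l => by
    rw [integral_finsetSum _ fun j _ => (hI _).const_mul _]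
    simp only [integral_const_mul]
  simp only [h2, Matrix.sub_apply, Matrix.mul_apply, Matrix.transpose_apply, Matrix.one_apply,
    mul_sub, sub_mul, Finset.sum_sub_distrib, Finset.mul_sum, Finset.sum_mul]
  rw [Finset.sum_comm, add_sub_assoc]
  congr 2
  · refine Finset.sum_congr rfl fun j _ => Finset.sum_congr rfl fun l _ => ?_
    ring
  · simp

/-- If `x ∼ 𝒩(a g w, 1 - a² w wᵀ)` then `𝔼[∏ i, h_{α i}(x i)] = a^|α| h_|α|(g) w^α`. -/
theorem integral_prod_he_gaussian (S : Matrix ι ι ℝ) (w : ι → ℝ) (a g : ℝ)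
    (hS : S * Sᵀ = 1 - a ^ 2 • Matrix.vecMulVec w w) (α : ι → ℕ) :
    ∫ z, ∏ i, he (α i) (((a * g) • w + S *ᵥ z) i) ∂(Measure.pi fun _ : ι => gaussianReal 0 1)
      = a ^ (∑ i, α i) * he (∑ i, α i) g * ∏ i, w i ^ α i := by
  simp only [← eval_hermiteAffine]
  obtain ⟨K, hK⟩ : ∃ K, K = ∑ i, α i := ⟨_, rfl⟩
  rw [← hK]
  induction K using Nat.strong_induction_on generalizing α with
  | _ K ih =>
    rcases Nat.eq_zero_or_pos K with rfl | hpos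
    · have h0 : α = 0 := by
        ext i
        exact (Finset.sum_eq_zero_iff.1 hK.symm) i (Finset.mem_univ i)
      subst h0
      simp only [eval_hermiteAffine]
      simp
    · obtain ⟨i, hi⟩ : ∃ i, α i ≠ 0 := by
        by_contra! h
        simp [h] at hK
        omega
      obtain ⟨K, rfl⟩ : ∃ K', K = K' + 1 := ⟨K - 1, by omega⟩
      obtain ⟨α', rfl⟩ : ∃ α', α = Function.update α' i (α' i + 1) :=
        ⟨Function.update α i (α i - 1), by
          rw [Function.update_idem, Function.update_self, Nat.sub_add_cancel (by omega),
            Function.update_eq_self]⟩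
      have hsum : ∀ (γ : ι → ℕ) (j : ι) (k : ℕ),
          ∑ x, Function.update γ j k x + γ j = ∑ x, γ x + k := fun γ j k => by
        rw [← Finset.add_sum_erase _ _ (Finset.mem_univ j),
          ← Finset.add_sum_erase _ γ (Finset.mem_univ j), Function.update_self,
          Finset.sum_congr rfl (g := γ) fun x hx => by
            rw [Function.update_of_ne (Finset.ne_of_mem_erase hx)]]
        ring
      have hprod : ∀ (γ : ι → ℕ) (j : ι),
          ∏ x, w x ^ Function.update γ j (γ j + 1) x = w j * ∏ x, w x ^ γ x := fun γ j => by
        rw [← Finset.mul_prod_erase _ _ (Finset.mem_univ j),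
          ← Finset.mul_prod_erase _ (fun x => w x ^ γ x) (Finset.mem_univ j), Function.update_self,
          Finset.prod_congr rfl (g := fun x => w x ^ γ x) fun x hx => by
            rw [Function.update_of_ne (Finset.ne_of_mem_erase hx)]]
        ring
      have hK' : K = ∑ x, α' x := by
        have := hsum α' i (α' i + 1)
        omega
      rw [integral_hermiteAffine_succ, ih K (by omega) α' hK', hS, hprod, he_succ]
      -- With defect `-a² w wᵀ`, each `j` contributes the same quantity up to the factor `α' j`.
      -- These factors sum to `K`, which reproduces the recurrence `h_{K+1}(g) = g h_K(g) - K
      -- h_{K-1}(g)`. The case `α' j = 0` is separate because `α' j - 1` truncates.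
      have h3 : ∀ j, (α' j : ℝ) * ((1 - a ^ 2 • Matrix.vecMulVec w w - 1 : Matrix ι ι ℝ) i j)
          * (∫ z, MvPolynomial.eval z (hermiteAffine S ((a * g) • w)
              (Function.update α' j (α' j - 1))) ∂(Measure.pi fun _ : ι => gaussianReal 0 1))
          = (α' j : ℝ) * (-(a ^ (K + 1) * he (K - 1) g * w i * ∏ x, w x ^ α' x)) := by
        intro j
        rcases Nat.eq_zero_or_pos (α' j) with h | h
        · simp [h]
        · have h4 := hsum α' j (α' j - 1)
          have h5 : K - 1 = ∑ x, Function.update α' j (α' j - 1) x := by omega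
          have h6 := hprod (Function.update α' j (α' j - 1)) j
          rw [Function.update_idem, Function.update_self, Nat.sub_add_cancel h,
            Function.update_eq_self] at h6
          have hKpos : 0 < K := by omega
          obtain ⟨L, rfl⟩ : ∃ L, K = L + 1 := ⟨K - 1, by omega⟩
          rw [ih _ (by omega) _ h5, h6]
          simp only [sub_sub_cancel_left, Matrix.neg_apply, Matrix.smul_apply, Matrix.vecMulVec_apply,
            smul_eq_mul, Nat.add_sub_cancel]
          ring
      rw [Finset.sum_congr rfl fun j _ => h3 j, ← Finset.sum_mul]
      have h7 : (∑ j, (α' j : ℝ)) = K := by rw [hK']; push_cast; rfl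
      rw [h7, Pi.smul_apply, smul_eq_mul]
      ring

end HermiteMoment

/-! ### The spiked sample given the spike -/

section Spike

variable {d : ℕ}

/-- The variance of the latent variable along the normalized spike, after whitening. -/
def latentWeight (β : ℝ) : ℝ := √(β / (1 + β))

theorem sq_latentWeight {β : ℝ} (hβ : 0 < β) : latentWeight β ^ 2 = β / (1 + β) :=
  Real.sq_sqrt (by positivity)

/-- With `s = √(1 + β)` one has `β = (s - 1)(s + 1)` and `1 + β + s = s (s + 1)`. When `|u|² = d`,
whitening therefore multiplies `u` by `1 / s` and fixes its orthogonal complement. -/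
theorem one_sub_whitening_coeff {β : ℝ} (hβ : 0 < β) :
    1 - β / (1 + β + √(1 + β)) = (√(1 + β))⁻¹ := by
  have h0 : 0 < √(1 + β) := Real.sqrt_pos.2 (by positivity)
  have h1 : √(1 + β) ^ 2 = 1 + β := Real.sq_sqrt (by positivity)
  field_simp
  nlinarith

theorem dotProduct_self_of_sq_eq_one {u : Fin d → ℝ} (hu : ∀ i, u i ^ 2 = 1) : u ⬝ᵥ u = d := by
  simp [dotProduct, ← pow_two, hu]

theorem whitening_mulVec (β : ℝ) (u y : Fin d → ℝ) :
    whitening β u *ᵥ y = y - (β / (1 + β + √(1 + β)) / d * (u ⬝ᵥ y)) • u := by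
  rw [whitening, Matrix.sub_mulVec, Matrix.one_mulVec, Matrix.smul_mulVec, Matrix.vecMulVec_mulVec]
  ext i
  simp
  ring

theorem spikedSample_eq {β : ℝ} (hβ : 0 < β) (hd : 0 < d) {u : Fin d → ℝ}
    (hu : ∀ i, u i ^ 2 = 1) (g : ℝ) (z : Fin d → ℝ) :
    spikedSample β u g z = (latentWeight β * g) • (fun i => u i / √d) + whitening β u *ᵥ z := by
  have hd' : (0 : ℝ) < d := by exact_mod_cast hd
  rw [spikedSample, Matrix.mulVec_add, Matrix.mulVec_smul, whitening_mulVec β u u,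
    dotProduct_self_of_sq_eq_one hu, div_mul_cancel₀ _ hd'.ne']
  congr 1
  ext i
  have h := one_sub_whitening_coeff hβ
  simp only [Pi.smul_apply, Pi.sub_apply, smul_eq_mul]
  have : u i - β / (1 + β + √(1 + β)) * u i = (√(1 + β))⁻¹ * u i := by rw [← h]; ring
  rw [this, latentWeight, Real.sqrt_div hβ.le, Real.sqrt_div hβ.le]
  field_simp

/-- The eigenvalue along the spike is `1 / (1 + β) = 1 - a²` with `a = latentWeight β`. This is the
hypothesis `hS` of `integral_prod_he_gaussian`. -/
theorem whitening_mul_transpose {β : ℝ} (hβ : 0 < β) (hd : 0 < d) {u : Fin d → ℝ}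
    (hu : ∀ i, u i ^ 2 = 1) :
    whitening β u * (whitening β u)ᵀ
      = 1 - latentWeight β ^ 2 • Matrix.vecMulVec (fun i => u i / √d) (fun i => u i / √d) := by
  have hd' : (0 : ℝ) < d := by exact_mod_cast hd
  have h := one_sub_whitening_coeff hβ
  set c := β / (1 + β + √(1 + β)) with hc
  have h2 : 2 * c - c ^ 2 = β / (1 + β) := by
    have h3 : (1 - c) ^ 2 = (1 + β)⁻¹ := by
      rw [h, inv_pow, Real.sq_sqrt (by positivity)]
    have h4 : β / (1 + β) = 1 - (1 + β)⁻¹ := by field_simp; ring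
    rw [h4, ← h3]; ring
  have hv : Matrix.vecMulVec u u * Matrix.vecMulVec u u = (d : ℝ) • Matrix.vecMulVec u u := by
    rw [Matrix.vecMulVec_mul_vecMulVec, dotProduct_self_of_sq_eq_one hu, Matrix.vecMulVec_smul]
  have hw : Matrix.vecMulVec (fun i => u i / √d) (fun i => u i / √d)
      = (d : ℝ)⁻¹ • Matrix.vecMulVec u u := by
    ext i j
    simp only [Matrix.vecMulVec_apply, Matrix.smul_apply, smul_eq_mul]
    have : √(d : ℝ) ^ 2 = d := Real.sq_sqrt hd'.le
    rw [div_mul_div_comm, ← pow_two, this]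
    field_simp
  rw [sq_latentWeight hβ, hw, whitening, ← hc, Matrix.transpose_sub, Matrix.transpose_one,
    Matrix.transpose_smul, Matrix.transpose_vecMulVec, sub_mul, one_mul, mul_sub, mul_one,
    Matrix.smul_mul, Matrix.mul_smul, hv, ← h2]
  simp only [smul_smul]
  ext i j
  simp only [Matrix.sub_apply, Matrix.smul_apply, smul_eq_mul]
  field_simp
  ring

theorem det_whitening {β : ℝ} (hβ : 0 < β) (hd : 0 < d) {u : Fin d → ℝ}
    (hu : ∀ i, u i ^ 2 = 1) : (whitening β u).det = (√(1 + β))⁻¹ := by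
  have hd' : (0 : ℝ) < d := by exact_mod_cast hd
  have h : whitening β u = 1 + Matrix.replicateCol Unit (-(β / (1 + β + √(1 + β)) / (d : ℝ)) • u)
      * Matrix.replicateRow Unit u := by
    rw [← Matrix.vecMulVec_eq, whitening, Matrix.smul_vecMulVec, neg_smul, sub_eq_add_neg]
  rw [h, Matrix.det_one_add_replicateCol_mul_replicateRow, dotProduct_smul,
    dotProduct_self_of_sq_eq_one hu, ← one_sub_whitening_coeff hβ]
  simp only [smul_eq_mul]
  field_simp
  ring

/-- Only the coordinate along the normalized spike changes: `σ` becomes `(√β g + σ) / √(1 + β)`. By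
Cauchy–Schwarz its square is at most `σ² + g²`. -/
theorem sum_sq_spikedSample_le {β : ℝ} (hβ : 0 < β) (hd : 0 < d) {u : Fin d → ℝ}
    (hu : ∀ i, u i ^ 2 = 1) (g : ℝ) (z : Fin d → ℝ) :
    ∑ i, spikedSample β u g z i ^ 2 ≤ ∑ i, z i ^ 2 + g ^ 2 := by
  have hd' : (0 : ℝ) < d := by exact_mod_cast hd
  have hs : 0 < √(d : ℝ) := Real.sqrt_pos.2 hd'
  have hsd : √(d : ℝ) ^ 2 = d := Real.sq_sqrt hd'.le
  have hb : √β ^ 2 = β := Real.sq_sqrt hβ.le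
  have h := one_sub_whitening_coeff hβ
  set σ := (u ⬝ᵥ z) / √d with hσ
  have hz : u ⬝ᵥ z = σ * √d := by rw [hσ]; field_simp
  have hc : ((√(1 + β))⁻¹) ^ 2 = (1 + β)⁻¹ := by rw [inv_pow, Real.sq_sqrt (by positivity)]
  set r := (√(1 + β))⁻¹ with hr
  set κ := r * (√β * g + σ) - σ with hκ
  have e : ∀ i, spikedSample β u g z i = z i + κ / √d * u i := by
    intro i
    rw [spikedSample_eq hβ hd hu, whitening_mulVec, hz,
      show β / (1 + β + √(1 + β)) = 1 - r by linarith, hκ, latentWeight, Real.sqrt_div hβ.le]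
    simp only [Pi.add_apply, Pi.smul_apply, Pi.sub_apply, smul_eq_mul]
    have h1 : (1 - r) / d * (σ * √d) = (1 - r) * σ / √d := by
      rw [div_mul_eq_mul_div, div_eq_div_iff hd'.ne' hs.ne']
      linear_combination (1 - r) * σ * hsd
    rw [h1, div_eq_mul_inv (√β), ← hr]
    ring
  have e2 : ∑ i, spikedSample β u g z i ^ 2 = ∑ i, z i ^ 2 + (2 * κ * σ + κ ^ 2) := by
    have : ∀ i, spikedSample β u g z i ^ 2
        = z i ^ 2 + 2 * (κ / √d) * (u i * z i) + (κ / √d) ^ 2 * u i ^ 2 := fun i => by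
      rw [e]; ring
    simp only [this, hu, Finset.sum_add_distrib, ← Finset.mul_sum]
    have hz' : ∑ i, u i * z i = σ * √d := hz
    rw [hz']
    simp only [Finset.sum_const, Finset.card_univ, Fintype.card_fin, nsmul_eq_mul, mul_one]
    rw [div_pow, hsd]
    field_simp
    ring
  rw [e2]
  have e3 : 2 * κ * σ + κ ^ 2 = (1 + β)⁻¹ * (√β * g + σ) ^ 2 - σ ^ 2 := by
    rw [← hc, hκ]; ring
  have e4 : (√β * g + σ) ^ 2 ≤ (1 + β) * (σ ^ 2 + g ^ 2) := by
    nlinarith [sq_nonneg (√β * σ - g)]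
  have e5 : (1 + β)⁻¹ * (√β * g + σ) ^ 2 ≤ σ ^ 2 + g ^ 2 := by
    rw [inv_mul_le_iff₀ (by positivity)]; exact e4
  linarith

end Spike

/-! ### Domination of the planted law by the null law -/

theorem pi_withDensity_ofReal {ι : Type*} [Fintype ι] (f : ℝ → ℝ) (hf0 : ∀ x, 0 ≤ f x)
    (hf : Integrable f) :
    Measure.pi (fun _ : ι => (volume : Measure ℝ).withDensity fun x => ENNReal.ofReal (f x))
      = (volume : Measure (ι → ℝ)).withDensity fun z => ENNReal.ofReal (∏ i, f (z i)) := by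
  have : IsFiniteMeasure ((volume : Measure ℝ).withDensity fun x => ENNReal.ofReal (f x)) :=
    isFiniteMeasure_withDensity_ofReal hf.2
  refine (Measure.pi_eq fun s hs => ?_)
  have h1 : ∀ i, Integrable ((s i).indicator f) := fun i => hf.indicator (hs i)
  have h2 : ∀ z : ι → ℝ, (Set.pi Set.univ s).indicator (fun z => ENNReal.ofReal (∏ i, f (z i))) z
      = ENNReal.ofReal (∏ i, (s i).indicator f (z i)) := by
    intro z
    by_cases hz : z ∈ Set.pi Set.univ s
    · rw [Set.indicator_of_mem hz]
      congr 1
      exact Finset.prod_congr rfl fun i _ => (Set.indicator_of_mem (hz i trivial) f).symm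
    · rw [Set.indicator_of_notMem hz]
      obtain ⟨i, hi⟩ : ∃ i, z i ∉ s i := by simpa [Set.mem_pi] using hz
      rw [Finset.prod_eq_zero (Finset.mem_univ i) (Set.indicator_of_notMem hi f), ENNReal.ofReal_zero]
  have h3 : ∀ i x, 0 ≤ (s i).indicator f x := fun i x => Set.indicator_nonneg (fun x _ => hf0 x) x
  have hms : MeasurableSet (Set.pi Set.univ s) := MeasurableSet.univ_pi hs
  rw [withDensity_apply _ hms, ← lintegral_indicator hms]
  simp only [h2]
  rw [volume_pi, ← ofReal_integral_eq_lintegral_ofReal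
      (Integrable.fintype_prod (f := fun i => (s i).indicator f) h1)
      (.of_forall fun z => Finset.prod_nonneg fun i _ => h3 i _),
    integral_fintype_prod_eq_prod (fun i => (s i).indicator f),
    ENNReal.ofReal_prod_of_nonneg fun i _ => integral_nonneg (h3 i)]
  refine Finset.prod_congr rfl fun i _ => ?_
  rw [withDensity_apply _ (hs i), integral_indicator (hs i),
    ofReal_integral_eq_lintegral_ofReal hf.integrableOn (.of_forall fun x => hf0 x)]

theorem pi_gaussianReal_eq_withDensity (ι : Type*) [Fintype ι] :
    (Measure.pi fun _ : ι => gaussianReal 0 1)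
      = (volume : Measure (ι → ℝ)).withDensity
          fun z => ENNReal.ofReal (∏ i, gaussianPDFReal 0 1 (z i)) := by
  rw [← pi_withDensity_ofReal _ (gaussianPDFReal_nonneg 0 1) (integrable_gaussianPDFReal 0 1)]
  simp only [gaussianReal_of_var_ne_zero _ one_ne_zero]
  rfl

theorem continuous_spikedSample {d : ℕ} (β : ℝ) :
    Continuous fun w : (Fin d → ℝ) × ℝ × (Fin d → ℝ) => spikedSample β w.1 w.2.1 w.2.2 := by
  unfold spikedSample whitening
  fun_prop

/-- The length bound compares the Gaussian densities at `z` and at the sample, at the cost of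
`exp(g² / 2)`. The change of variables, a translation followed by the whitening map, costs the
inverse determinant `√(1 + β)`. -/
theorem map_spikedSample_le {d : ℕ} {β : ℝ} (hβ : 0 < β) (hd : 0 < d) {u : Fin d → ℝ}
    (hu : ∀ i, u i ^ 2 = 1) (g : ℝ) :
    (Measure.pi fun _ : Fin d => gaussianReal 0 1).map (spikedSample β u g)
      ≤ ENNReal.ofReal (√(1 + β) * Real.exp (g ^ 2 / 2))
        • Measure.pi fun _ : Fin d => gaussianReal 0 1 := by
  have hr : 0 < √(1 + β) := Real.sqrt_pos.2 (by positivity)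
  have hcont : Continuous (spikedSample β u g) :=
    (continuous_spikedSample β).comp (by fun_prop : Continuous fun z : Fin d → ℝ => (u, g, z))
  have hm : Measurable (spikedSample β u g) := hcont.measurable
  refine Measure.le_iff.2 fun A hA => ?_
  rw [Measure.map_apply hm hA, Measure.smul_apply, smul_eq_mul, pi_gaussianReal_eq_withDensity,
    withDensity_apply _ (hm hA), withDensity_apply _ hA, ← lintegral_indicator hA,
    ← lintegral_indicator (hm hA)]
  set φ : (Fin d → ℝ) → ℝ≥0∞ := fun z => ENNReal.ofReal (∏ i, gaussianPDFReal 0 1 (z i)) with hφ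
  have hφm : Measurable φ := by
    refine ENNReal.measurable_ofReal.comp (Finset.measurable_prod _ fun i _ => ?_)
    exact (measurable_gaussianPDFReal 0 1).comp (measurable_pi_apply i)
  have hprod : ∀ z : Fin d → ℝ, ∏ i, gaussianPDFReal 0 1 (z i)
      = (√(2 * Real.pi))⁻¹ ^ d * Real.exp (-(∑ i, z i ^ 2) / 2) := by
    intro z
    simp only [gaussianPDFReal, Finset.prod_mul_distrib, Finset.prod_const, Finset.card_univ,
      Fintype.card_fin, ← Real.exp_sum]
    simp [Finset.sum_neg_distrib, ← Finset.sum_div, neg_div]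
  have hle : ∀ z, φ z ≤ ENNReal.ofReal (Real.exp (g ^ 2 / 2)) * φ (spikedSample β u g z) := by
    intro z
    rw [hφ, ← ENNReal.ofReal_mul (Real.exp_pos _).le]
    refine ENNReal.ofReal_le_ofReal ?_
    rw [hprod, hprod, mul_left_comm, ← Real.exp_add]
    gcongr
    have := sum_sq_spikedSample_le hβ hd hu g z
    linarith
  have hF : Measurable (A.indicator φ) := hφm.indicator hA
  calc ∫⁻ z, (spikedSample β u g ⁻¹' A).indicator φ z
      ≤ ∫⁻ z, ENNReal.ofReal (Real.exp (g ^ 2 / 2)) * A.indicator φ (spikedSample β u g z) := by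
        refine lintegral_mono fun z => ?_
        by_cases hz : spikedSample β u g z ∈ A
        · rw [Set.indicator_of_mem hz, Set.indicator_of_mem (show z ∈ _ ⁻¹' A from hz)]
          exact hle z
        · rw [Set.indicator_of_notMem (show z ∉ _ ⁻¹' A from hz)]
          exact zero_le
    _ = ENNReal.ofReal (Real.exp (g ^ 2 / 2))
        * ∫⁻ z, A.indicator φ (whitening β u *ᵥ ((√(β / (d : ℝ)) * g) • u + z)) :=
        lintegral_const_mul _ (hF.comp hm)
    _ = ENNReal.ofReal (Real.exp (g ^ 2 / 2))
        * ∫⁻ z, A.indicator φ (whitening β u *ᵥ z) := by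
        rw [lintegral_add_left_eq_self (fun z => A.indicator φ (whitening β u *ᵥ z))]
    _ = ENNReal.ofReal (√(1 + β) * Real.exp (g ^ 2 / 2)) * ∫⁻ z, A.indicator φ z := by
        have hdet := det_whitening hβ hd hu
        have hmap := Real.map_matrix_volume_pi_eq_smul_volume_pi (M := whitening β u)
          (by rw [hdet]; positivity)
        have := lintegral_map (μ := volume) hF
          (show Measurable (Matrix.toLin' (whitening β u)) from
            (LinearMap.continuous_of_finiteDimensional _).measurable)
        simp only [Matrix.toLin'_apply] at this
        rw [← this, hmap, lintegral_smul_measure, hdet, inv_inv, abs_of_pos hr, smul_eq_mul,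
          ← mul_assoc, ← ENNReal.ofReal_mul (Real.exp_pos _).le, mul_comm (√(1 + β))]

/-- It suffices to compare on boxes, since `OuterMeasure.pi` is the largest outer measure bounded on
boxes by the product of the side masses. -/
theorem pi_le_smul_pi {ι : Type*} [Fintype ι] {X : ι → Type*} [∀ i, MeasurableSpace (X i)]
    {ν μ : ∀ i, Measure (X i)} [∀ i, IsFiniteMeasure (ν i)] [∀ i, IsFiniteMeasure (μ i)]
    {c : ι → ℝ≥0∞} (hc : ∀ i, c i ≠ ∞) (h : ∀ i, ν i ≤ c i • μ i) :
    Measure.pi ν ≤ (∏ i, c i) • Measure.pi μ := by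
  have : ∀ i, IsFiniteMeasure (c i • μ i) := fun i =>
    ⟨by rw [Measure.smul_apply, smul_eq_mul]
        exact ENNReal.mul_lt_top (hc i).lt_top (measure_lt_top _ _)⟩
  have e : (∏ i, c i) • Measure.pi μ = Measure.pi fun i => c i • μ i := by
    refine (Measure.pi_eq fun s _ => ?_).symm
    rw [Measure.smul_apply, Measure.pi_pi, smul_eq_mul, ← Finset.prod_mul_distrib]
    rfl
  rw [e]
  refine Measure.le_iff.2 fun A hA => ?_
  have : (Measure.pi ν).toOuterMeasure ≤ OuterMeasure.pi fun i => (c i • μ i).toOuterMeasure := by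
    rw [OuterMeasure.le_pi]
    intro s _
    refine (Measure.pi_pi ν s).le.trans ?_
    exact Finset.prod_le_prod' fun i _ => (h i) (s i)
  refine (this A).trans_eq ?_
  rw [Measure.pi, toMeasure_apply _ _ hA]

instance : IsProbabilityMeasure rademacher :=
  ⟨by simp [rademacher, ENNReal.inv_two_add_inv_two]⟩

theorem ae_rademacher : ∀ᵐ x ∂rademacher, x ^ 2 = 1 := by
  rw [rademacher, ae_add_measure_iff]
  constructor <;>
  · refine Measure.ae_smul_measure ?_ _
    simp [ae_dirac_eq]

theorem ae_pi_rademacher (d : ℕ) :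
    ∀ᵐ u ∂(Measure.pi fun _ : Fin d => rademacher), ∀ i, u i ^ 2 = 1 := by
  rw [ae_all_iff]
  exact fun i => (Measure.quasiMeasurePreserving_eval (fun _ : Fin d => rademacher) i).ae
    ae_rademacher

instance (n d : ℕ) : IsProbabilityMeasure (nullMeasure n d) := by
  unfold nullMeasure; infer_instance

theorem measurable_spikedMap (β : ℝ) (n d : ℕ) :
    Measurable fun (w : (Fin d → ℝ) × (Fin n → ℝ) × (Fin n → Fin d → ℝ)) (μ : Fin n) =>
      spikedSample β w.1 (w.2.1 μ) (w.2.2 μ) := by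
  refine measurable_pi_lambda _ fun μ => ?_
  exact ((continuous_spikedSample β).comp (by fun_prop :
    Continuous fun w : (Fin d → ℝ) × (Fin n → ℝ) × (Fin n → Fin d → ℝ) =>
      (w.1, w.2.1 μ, w.2.2 μ))).measurable

instance (β : ℝ) (p : Measure ℝ) [IsProbabilityMeasure p] (n d : ℕ) :
    IsProbabilityMeasure (spikedMeasure β p n d) :=
  Measure.isProbabilityMeasure_map (measurable_spikedMap β n d).aemeasurable

/-- For fixed `u` and `g` the rows are independent and each is dominated by `map_spikedSample_le`.
The product of these constants does not depend on `u`, and its mean over `g` is finite because it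
factorizes into integrals of `exp(x² / 2)`. -/
theorem spikedMeasure_le {β : ℝ} (hβ : 0 < β) {p : Measure ℝ} [IsProbabilityMeasure p]
    (hp : Integrable (fun x : ℝ => Real.exp (x ^ 2 / 2)) p) (n : ℕ) {d : ℕ} (hd : 0 < d) :
    ∃ C : ℝ≥0∞, C ≠ ∞ ∧ spikedMeasure β p n d ≤ C • nullMeasure n d := by
  set c : (Fin n → ℝ) → ℝ≥0∞ :=
    fun g => ∏ μ, ENNReal.ofReal (√(1 + β) * Real.exp (g μ ^ 2 / 2)) with hc
  refine ⟨∫⁻ g, c g ∂(Measure.pi fun _ : Fin n => p), ?_, ?_⟩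
  · have h := (Integrable.fintype_prod (ι := Fin n) (μ := fun _ => p)
      (f := fun _ x => √(1 + β) * Real.exp (x ^ 2 / 2)) fun _ => hp.const_mul _).lintegral_lt_top
    have h2 : ∀ g : Fin n → ℝ, ENNReal.ofReal (∏ μ, √(1 + β) * Real.exp (g μ ^ 2 / 2)) = c g :=
      fun g => ENNReal.ofReal_prod_of_nonneg fun _ _ => by positivity
    simp only [h2] at h
    exact h.ne
  refine Measure.le_iff.2 fun A hA => ?_
  have hm := measurable_spikedMap β n d
  rw [spikedMeasure, Measure.map_apply hm hA, Measure.prod_apply (hm hA), Measure.smul_apply,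
    smul_eq_mul]
  have hcm : Measurable c := by
    refine Finset.measurable_prod _ fun μ _ => ENNReal.measurable_ofReal.comp ?_
    fun_prop
  have hu : ∀ᵐ u ∂(Measure.pi fun _ : Fin d => rademacher),
      ((Measure.pi fun _ : Fin n => p).prod (nullMeasure n d)) (Prod.mk u ⁻¹'
        ((fun (w : (Fin d → ℝ) × (Fin n → ℝ) × (Fin n → Fin d → ℝ)) (μ : Fin n) =>
          spikedSample β w.1 (w.2.1 μ) (w.2.2 μ)) ⁻¹' A))
      ≤ (∫⁻ g, c g ∂(Measure.pi fun _ : Fin n => p)) * nullMeasure n d A := by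
    filter_upwards [ae_pi_rademacher d] with u hu
    rw [Measure.prod_apply (measurable_prodMk_left (hm hA)), ← lintegral_mul_const _ hcm]
    refine lintegral_mono fun g => ?_
    have hT : ∀ μ, Measurable (spikedSample β u (g μ)) := fun μ =>
      ((continuous_spikedSample β).comp
        (by fun_prop : Continuous fun z : Fin d → ℝ => (u, g μ, z))).measurable
    have : ∀ μ, IsProbabilityMeasure
        ((Measure.pi fun _ : Fin d => gaussianReal 0 1).map (spikedSample β u (g μ))) := fun μ =>
      Measure.isProbabilityMeasure_map (hT μ).aemeasurable
    have h1 := pi_le_smul_pi (c := fun μ => ENNReal.ofReal (√(1 + β) * Real.exp (g μ ^ 2 / 2)))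
      (fun _ => ENNReal.ofReal_ne_top) fun μ => map_spikedSample_le hβ hd hu (g μ)
    rw [← Measure.pi_map_pi fun μ => (hT μ).aemeasurable] at h1
    have h2 := h1 A
    have hm2 : Measurable fun (x : Fin n → Fin d → ℝ) μ => spikedSample β u (g μ) (x μ) :=
      measurable_pi_lambda _ fun μ => (hT μ).comp (measurable_pi_apply μ)
    rw [Measure.map_apply hm2 hA] at h2
    exact h2
  refine (lintegral_mono_ae hu).trans ?_
  simp

/-! ### The likelihood ratio -/

theorem absolutelyContinuous_of_le_smul {Ω : Type*} [MeasurableSpace Ω] {P Q : Measure Ω}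
    {C : ℝ≥0∞} (h : P ≤ C • Q) : P ≪ Q :=
  (Measure.absolutelyContinuous_of_le h).trans Measure.smul_absolutelyContinuous

theorem memLp_likelihoodRatio {Ω : Type*} [MeasurableSpace Ω] {P Q : Measure Ω}
    [IsFiniteMeasure P] [IsFiniteMeasure Q] {C : ℝ≥0∞} (hC : C ≠ ∞) (h : P ≤ C • Q) :
    MemLp (likelihoodRatio P Q) 2 Q := by
  have hac := absolutelyContinuous_of_le_smul h
  have h1 : P.rnDeriv Q ≤ᵐ[Q] fun _ => C := by
    refine ae_le_of_forall_setLIntegral_le_of_sigmaFinite (Measure.measurable_rnDeriv P Q)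
      fun s hs _ => ?_
    rw [Measure.setLIntegral_rnDeriv hac, setLIntegral_const]
    exact h s
  refine MemLp.of_bound (Measure.measurable_rnDeriv P Q).ennreal_toReal.aestronglyMeasurable
    C.toReal ?_
  filter_upwards [h1] with x hx
  rw [likelihoodRatio, Real.norm_of_nonneg ENNReal.toReal_nonneg]
  exact ENNReal.toReal_mono hC hx

/-! ### Hermite coefficients of the latent distribution -/

section Latent

variable {p : Measure ℝ} {Λ : ℝ}

theorem hermiteCoeff_eq (p : Measure ℝ) (k : ℕ) : hermiteCoeff p k = ∫ x, he k x ∂p := rfl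

theorem integrable_he_of_exp (hp : Integrable (fun x : ℝ => Real.exp (x ^ 2 / 2)) p) (k : ℕ) :
    Integrable (he k) p := by
  refine (hp.const_mul (√((2 * k : ℝ) ^ k))).mono (measurable_he k).aestronglyMeasurable
    (.of_forall fun x => ?_)
  rw [Real.norm_eq_abs, Real.norm_of_nonneg (by positivity)]
  exact abs_he_le_exp k x

/-- A two-sided control of the coefficient; its case `k = 0` also shows that the squared exponential
moment is at least one. -/
theorem sq_hermiteCoeff_le (hp : Integrable (fun x : ℝ => Real.exp (x ^ 2 / 2)) p) (k : ℕ) :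
    hermiteCoeff p k ^ 2 ≤ (2 * k) ^ k * (∫ x, Real.exp (x ^ 2 / 2) ∂p) ^ 2 := by
  have h : |hermiteCoeff p k| ≤ √((2 * k : ℝ) ^ k) * ∫ x, Real.exp (x ^ 2 / 2) ∂p := by
    rw [hermiteCoeff_eq, ← integral_const_mul]
    refine (abs_integral_le_integral_abs).trans ?_
    exact integral_mono (integrable_he_of_exp hp k).abs (hp.const_mul _) fun x => abs_he_le_exp k x
  rw [← sq_abs]
  calc |hermiteCoeff p k| ^ 2
      ≤ (√((2 * k : ℝ) ^ k) * ∫ x, Real.exp (x ^ 2 / 2) ∂p) ^ 2 := by gcongr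
    _ = _ := by rw [mul_pow, Real.sq_sqrt (by positivity)]

theorem hermiteCoeff_zero [IsProbabilityMeasure p] : hermiteCoeff p 0 = 1 := by
  simp [hermiteCoeff_eq]

theorem hermiteCoeff_of_odd (hp : LatentAssumption p Λ) {k : ℕ} (hk : Odd k) :
    hermiteCoeff p k = 0 := by
  have h : ∫ x, he k x ∂p = ∫ x, he k (-x) ∂p := by
    conv_lhs => rw [← hp.even]
    exact integral_map (by fun_prop) (measurable_he k).aestronglyMeasurable
  simp only [he_neg, hk.neg_one_pow, neg_one_mul, integral_neg] at h
  rw [hermiteCoeff_eq]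
  linarith

theorem integral_sq_latent [IsProbabilityMeasure p] (hp : LatentAssumption p Λ) :
    ∫ x, x ^ 2 ∂p = 1 := by
  rw [← hp.variance_one, variance_of_integral_eq_zero (by fun_prop) hp.mean_zero]

/-- Unit variance gives this, and symmetry gives `hermiteCoeff_of_odd`; so order four is the first
positive order at which a coefficient can be nonzero. This is the source of the exponent `m / 4`. -/
theorem hermiteCoeff_two [IsProbabilityMeasure p] (hp : LatentAssumption p Λ) :
    hermiteCoeff p 2 = 0 := by
  have h := integrable_he_of_exp hp.exp_integrable 2
  have e : ∀ x, x ^ 2 = he 2 x + 1 := fun x => by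
    rw [he_succ]; simp; ring
  have h2 := integral_sq_latent hp
  simp only [e] at h2
  rw [integral_add h (integrable_const _)] at h2
  simpa [hermiteCoeff_eq] using h2

theorem hermiteCoeff_four [IsProbabilityMeasure p] (hp : LatentAssumption p Λ) :
    hermiteCoeff p 4 = kappa4 p := by
  have h := integrable_he_of_exp hp.exp_integrable
  have e : ∀ x, x ^ 4 = he 4 x + 6 * he 2 x + 3 := fun x => by
    rw [he_succ, he_succ, he_succ]; simp; ring
  have h2 := hermiteCoeff_two hp
  rw [hermiteCoeff_eq] at h2
  have i1 : Integrable (fun x => he 4 x + 6 * he 2 x) p := (h 4).add ((h 2).const_mul 6)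
  rw [kappa4, integral_sq_latent hp]
  simp only [e]
  rw [integral_add i1 (integrable_const _), integral_add (h 4) ((h 2).const_mul 6),
    integral_const_mul, h2, hermiteCoeff_eq]
  simp

end Latent

/-! ### Products of Hermite polynomials -/

section Tensor

variable {n d : ℕ}

/-- The product of the Hermite polynomials `h_{α μ i}` in the entries of the data matrix. -/
def hermiteTensor (α : Fin n → Fin d → ℕ) (x : Fin n → Fin d → ℝ) : ℝ :=
  ∏ μ, ∏ i, he (α μ i) (x μ i)

theorem measurable_hermiteTensor (α : Fin n → Fin d → ℕ) : Measurable (hermiteTensor α) := by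
  refine Finset.measurable_prod _ fun μ _ => Finset.measurable_prod _ fun i _ => ?_
  exact (measurable_he _).comp (by fun_prop)

theorem integrable_hermiteTensor (α : Fin n → Fin d → ℕ) :
    Integrable (hermiteTensor α) (nullMeasure n d) := by
  refine Integrable.fintype_prod (f := fun μ (x : Fin d → ℝ) => ∏ i, he (α μ i) (x i)) fun μ => ?_
  refine Integrable.fintype_prod (f := fun i x => he (α μ i) x) fun i => ?_
  simpa using integrable_he_mul_he (α μ i) 0

theorem integrable_hermiteTensor_mul (α α' : Fin n → Fin d → ℕ) :
    Integrable (fun x => hermiteTensor α x * hermiteTensor α' x) (nullMeasure n d) := by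
  simp only [hermiteTensor, ← Finset.prod_mul_distrib]
  refine Integrable.fintype_prod
    (f := fun μ (x : Fin d → ℝ) => ∏ i, he (α μ i) (x i) * he (α' μ i) (x i)) fun μ => ?_
  exact Integrable.fintype_prod (f := fun i x => he (α μ i) x * he (α' μ i) x)
    fun i => integrable_he_mul_he _ _

theorem integral_hermiteTensor_mul (α α' : Fin n → Fin d → ℕ) :
    ∫ x, hermiteTensor α x * hermiteTensor α' x ∂(nullMeasure n d)
      = if α = α' then ∏ μ, ∏ i, ((α μ i).factorial : ℝ) else 0 := by
  simp only [hermiteTensor, ← Finset.prod_mul_distrib, nullMeasure]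
  rw [integral_fintype_prod_eq_prod
    (fun μ (x : Fin d → ℝ) => ∏ i, he (α μ i) (x i) * he (α' μ i) (x i))]
  have h : ∀ μ, ∫ x, ∏ i, he (α μ i) (x i) * he (α' μ i) (x i)
      ∂(Measure.pi fun _ : Fin d => gaussianReal 0 1)
      = ∏ i, if α μ i = α' μ i then ((α μ i).factorial : ℝ) else 0 := fun μ => by
    rw [integral_fintype_prod_eq_prod (fun i x => he (α μ i) x * he (α' μ i) x)]
    simp only [integral_he_mul_he]
  simp only [h]
  split_ifs with hα
  · simp [hα]
  · obtain ⟨μ, hμ⟩ := Function.ne_iff.1 hα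
    obtain ⟨i, hi⟩ := Function.ne_iff.1 hμ
    exact Finset.prod_eq_zero (Finset.mem_univ μ)
      (Finset.prod_eq_zero (Finset.mem_univ i) (if_neg hi))

theorem integral_pow_rademacher (k : ℕ) :
    ∫ x, x ^ k ∂rademacher = if Even k then 1 else 0 := by
  have h : ∀ y : ℝ, Integrable (fun x : ℝ => x ^ k) ((2⁻¹ : ℝ≥0∞) • Measure.dirac y) := fun y =>
    (integrable_dirac (by simp)).smul_measure (by simp)
  rw [rademacher, integral_add_measure (h _) (h _), integral_smul_measure, integral_smul_measure,
    integral_dirac, integral_dirac]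
  split_ifs with hk
  · simp [hk.neg_one_pow]; norm_num
  · simp [(Nat.not_even_iff_odd.1 hk).neg_one_pow]

theorem integrable_pow_rademacher (k : ℕ) : Integrable (fun x : ℝ => x ^ k) rademacher := by
  have h : ∀ y : ℝ, Integrable (fun x : ℝ => x ^ k) ((2⁻¹ : ℝ≥0∞) • Measure.dirac y) := fun y =>
    (integrable_dirac (by simp)).smul_measure (by simp)
  exact (h _).add_measure (h _)

theorem integral_prod_pow_rademacher (γ : Fin d → ℕ) :
    ∫ u, ∏ i, u i ^ γ i ∂(Measure.pi fun _ : Fin d => rademacher)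
      = ∏ i, if Even (γ i) then 1 else 0 := by
  rw [integral_fintype_prod_eq_prod (fun i x => x ^ γ i)]
  simp only [integral_pow_rademacher]

theorem integrable_prod_pow_rademacher (γ : Fin d → ℕ) :
    Integrable (fun u => ∏ i, u i ^ γ i) (Measure.pi fun _ : Fin d => rademacher) :=
  Integrable.fintype_prod (f := fun i x => x ^ γ i) fun _ => integrable_pow_rademacher _

/-- Given `u` and `g` the rows are independent and `integral_prod_he_gaussian` applies to each. The
remaining dependence on `u` is a monomial whose exponents are the column sums, and its Rademacher
mean is one or zero according to parity. -/
theorem integral_hermiteTensor_spikedMeasure {β : ℝ} (hβ : 0 < β) {p : Measure ℝ}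
    [IsProbabilityMeasure p] (hp : Integrable (fun x : ℝ => Real.exp (x ^ 2 / 2)) p) (hd : 0 < d)
    (α : Fin n → Fin d → ℕ) :
    ∫ x, hermiteTensor α x ∂(spikedMeasure β p n d)
      = (∏ μ, latentWeight β ^ (∑ i, α μ i) * hermiteCoeff p (∑ i, α μ i) / √d ^ (∑ i, α μ i))
        * ∏ i, if Even (∑ μ, α μ i) then 1 else 0 := by
  obtain ⟨C, hC, hle⟩ := spikedMeasure_le hβ hp n hd
  -- Integrability under the planted law is inherited from the null law by domination.
  have hint : Integrable (hermiteTensor α) (spikedMeasure β p n d) :=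
    ((integrable_hermiteTensor α).smul_measure hC).mono_measure hle
  have hm := measurable_spikedMap β n d
  have hmeas := (measurable_hermiteTensor α).aestronglyMeasurable (μ := spikedMeasure β p n d)
  rw [spikedMeasure] at hint hmeas ⊢
  rw [integral_map hm.aemeasurable hmeas]
  have hint' := (integrable_map_measure hmeas hm.aemeasurable).1 hint
  simp only [Function.comp_def] at hint'
  rw [integral_prod _ hint', ← integral_prod_pow_rademacher, ← integral_const_mul]
  refine integral_congr_ae ?_
  filter_upwards [hint'.prod_right_ae, ae_pi_rademacher d] with u hu hu1
  rw [integral_prod _ hu]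
  simp only [hermiteTensor]
  have h1 : ∀ g : Fin n → ℝ,
      ∫ z, ∏ μ, ∏ i, he (α μ i) (spikedSample β u (g μ) (z μ) i) ∂(nullMeasure n d)
        = ∏ μ, latentWeight β ^ (∑ i, α μ i) * he (∑ i, α μ i) (g μ)
            * ∏ i, (u i / √d) ^ α μ i := fun g => by
    rw [nullMeasure, integral_fintype_prod_eq_prod
      (fun μ (z : Fin d → ℝ) => ∏ i, he (α μ i) (spikedSample β u (g μ) z i))]
    refine Finset.prod_congr rfl fun μ _ => ?_
    simp only [spikedSample_eq hβ hd hu1]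
    exact integral_prod_he_gaussian (whitening β u) (fun i => u i / √d) (latentWeight β) (g μ)
      (whitening_mul_transpose hβ hd hu1) (α μ)
  simp only [h1]
  rw [integral_fintype_prod_eq_prod (fun μ x => latentWeight β ^ (∑ i, α μ i)
    * he (∑ i, α μ i) x * ∏ i, (u i / √d) ^ α μ i)]
  have h3 : ∀ μ, ∏ i, (u i / √d) ^ α μ i = (∏ i, u i ^ α μ i) / √d ^ (∑ i, α μ i) := fun μ => by
    simp only [div_pow, Finset.prod_div_distrib, Finset.prod_pow_eq_pow_sum]
  simp only [integral_mul_const, integral_const_mul, ← hermiteCoeff_eq, h3]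
  have h2 : ∏ i, u i ^ (∑ μ, α μ i) = ∏ μ, ∏ i, u i ^ α μ i := by
    rw [Finset.prod_comm]
    simp only [Finset.prod_pow_eq_pow_sum]
  rw [h2, ← Finset.prod_mul_distrib]
  refine Finset.prod_congr rfl fun μ _ => ?_
  ring

end Tensor

/-! ### Hermite polynomials span the polynomials of bounded degree -/

section Span

variable {ι : Type*} [Fintype ι] [DecidableEq ι]

set_option linter.unusedSectionVars false

theorem affineForm_one_zero (i : ι) : affineForm 1 0 i = (MvPolynomial.X i : MvPolynomial ι ℝ) := by
  simp only [affineForm, Pi.zero_apply, map_zero, zero_add, Matrix.one_apply]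
  rw [Finset.sum_eq_single i] <;> simp +contextual [eq_comm]

/-- The span of the products of Hermite polynomials of total degree at most `D`. -/
def hermiteSpan (ι : Type*) [Fintype ι] [DecidableEq ι] (D : ℕ) :
    Submodule ℝ (MvPolynomial ι ℝ) :=
  Submodule.span ℝ (hermiteAffine 1 0 '' {α : ι → ℕ | ∑ i, α i ≤ D})

/-- The recurrence read backwards: `X_i h_α = h_{α + e_i} + α_i h_{α - e_i}`. With `S = 1` and `v =
0` the affine forms are the coordinates, so `hermiteAffine 1 0` gives ordinary Hermite products, and
monomials are reached by induction on the degree. -/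
theorem X_mul_mem_hermiteSpan {D : ℕ} (i : ι) {q : MvPolynomial ι ℝ} (hq : q ∈ hermiteSpan ι D) :
    MvPolynomial.X i * q ∈ hermiteSpan ι (D + 1) := by
  induction hq using Submodule.span_induction with
  | mem q h =>
    obtain ⟨α, hα, rfl⟩ := h
    have hα' : ∑ x, α x ≤ D := hα
    have h := hermiteAffine_succ 1 0 α i
    rw [affineForm_one_zero] at h
    have hsum : ∀ k : ℕ, ∑ x, Function.update α i k x + α i = ∑ x, α x + k := fun k => by
      rw [Finset.sum_update_of_mem (Finset.mem_univ i),
        ← Finset.add_sum_erase _ α (Finset.mem_univ i), Finset.sdiff_singleton_eq_erase]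
      ring
    have e : MvPolynomial.X i * hermiteAffine 1 0 α
        = hermiteAffine 1 0 (Function.update α i (α i + 1))
          + (α i : ℝ) • hermiteAffine 1 0 (Function.update α i (α i - 1)) := by
      rw [h, MvPolynomial.smul_eq_C_mul]; ring
    rw [e]
    refine Submodule.add_mem _ (Submodule.subset_span ⟨_, ?_, rfl⟩)
      (Submodule.smul_mem _ _ (Submodule.subset_span ⟨_, ?_, rfl⟩))
    · have := hsum (α i + 1)
      simp only [Set.mem_ofPred_eq]
      omega
    · have := hsum (α i - 1)
      simp only [Set.mem_ofPred_eq]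
      omega
  | zero => simp
  | add x y _ _ hx hy => rw [mul_add]; exact Submodule.add_mem _ hx hy
  | smul c x _ hx => rw [mul_smul_comm]; exact Submodule.smul_mem _ _ hx

theorem monomial_mem_hermiteSpan (s : ι →₀ ℕ) :
    MvPolynomial.monomial s (1 : ℝ) ∈ hermiteSpan ι s.degree := by
  obtain ⟨K, hK⟩ : ∃ K, K = s.degree := ⟨_, rfl⟩
  rw [← hK]
  induction K generalizing s with
  | zero =>
    rw [(Finsupp.degree_eq_zero_iff s).1 hK.symm]
    refine Submodule.subset_span ⟨0, by simp, ?_⟩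
    simp [hermiteAffine, hePoly]
  | succ K ih =>
    obtain ⟨i, hi⟩ : ∃ i, s i ≠ 0 := by
      by_contra! h
      rw [(Finsupp.degree_eq_zero_iff s).2 (Finsupp.ext h)] at hK
      omega
    have hs : Finsupp.single i 1 + (s - Finsupp.single i 1) = s :=
      add_tsub_cancel_of_le (Finsupp.single_le_iff.2 (Nat.one_le_iff_ne_zero.2 hi))
    have hdeg : K = (s - Finsupp.single i 1).degree := by
      have := congrArg Finsupp.degree hs
      rw [map_add, Finsupp.degree_single] at this
      omega
    have h := X_mul_mem_hermiteSpan i (ih _ hdeg)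
    rwa [MvPolynomial.X, MvPolynomial.monomial_mul, hs, one_mul] at h

theorem mem_hermiteSpan {D : ℕ} {q : MvPolynomial ι ℝ} (hq : q.totalDegree ≤ D) :
    q ∈ hermiteSpan ι D := by
  rw [q.as_sum]
  refine Submodule.sum_mem _ fun s hs => ?_
  have h1 := MvPolynomial.le_totalDegree hs
  have h2 : MvPolynomial.monomial s (q.coeff s)
      = q.coeff s • MvPolynomial.monomial s (1 : ℝ) := by
    rw [MvPolynomial.smul_monomial, smul_eq_mul, mul_one]
  rw [h2]
  refine Submodule.smul_mem _ _ (Submodule.span_mono (Set.image_mono ?_)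
    (monomial_mem_hermiteSpan s))
  intro α hα
  exact le_trans hα (le_trans (by rw [Finsupp.degree]; exact h1) hq)

theorem totalDegree_aeval_X_le (i : ι) (q : Polynomial ℝ) :
    (Polynomial.aeval (MvPolynomial.X i : MvPolynomial ι ℝ) q).totalDegree ≤ q.natDegree := by
  rw [Polynomial.aeval_eq_sum_range]
  refine MvPolynomial.totalDegree_finsetSum_le fun k hk => ?_
  refine (MvPolynomial.totalDegree_smul_le _ _).trans ?_
  rw [MvPolynomial.totalDegree_X_pow]
  have := Finset.mem_range.1 hk
  omega

theorem totalDegree_hermiteAffine_le (α : ι → ℕ) :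
    (hermiteAffine 1 0 α : MvPolynomial ι ℝ).totalDegree ≤ ∑ i, α i := by
  refine (MvPolynomial.totalDegree_finsetProd _ _).trans (Finset.sum_le_sum fun i _ => ?_)
  rw [affineForm_one_zero]
  refine (totalDegree_aeval_X_le i _).trans ?_
  rw [hePoly]
  exact Polynomial.natDegree_map_le.trans Polynomial.natDegree_hermite.le

end Span

/-! ### The norm of the low-degree likelihood ratio -/

section Projection

variable {n d : ℕ}

/-- The multi-indices of total degree at most `D`. -/
def multiIndices (n d D : ℕ) : Finset (Fin n → Fin d → ℕ) :=
  (Fintype.piFinset fun _ => Fintype.piFinset fun _ => Finset.range (D + 1)).filter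
    fun α => ∑ μ, ∑ i, α μ i ≤ D

theorem mem_multiIndices {D : ℕ} {α : Fin n → Fin d → ℕ} :
    α ∈ multiIndices n d D ↔ ∑ μ, ∑ i, α μ i ≤ D := by
  simp only [multiIndices, Finset.mem_filter, Fintype.mem_piFinset, Finset.mem_range,
    and_iff_right_iff_imp]
  intro h μ i
  have h1 : α μ i ≤ ∑ i, α μ i := Finset.single_le_sum (fun _ _ => zero_le) (Finset.mem_univ i)
  have h2 : ∑ i, α μ i ≤ ∑ μ, ∑ i, α μ i :=
    Finset.single_le_sum (f := fun μ => ∑ i, α μ i) (fun _ _ => zero_le) (Finset.mem_univ μ)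
  omega

theorem memLp_hermiteTensor (α : Fin n → Fin d → ℕ) :
    MemLp (hermiteTensor α) 2 (nullMeasure n d) := by
  rw [memLp_two_iff_integrable_sq (measurable_hermiteTensor α).aestronglyMeasurable]
  simpa only [pow_two] using integrable_hermiteTensor_mul α α

/-- The product of Hermite polynomials as an element of `L²`. -/
def hermiteLp (α : Fin n → Fin d → ℕ) : Lp ℝ 2 (nullMeasure n d) :=
  (memLp_hermiteTensor α).toLp _

theorem coeFn_hermiteLp (α : Fin n → Fin d → ℕ) :
    hermiteLp α =ᵐ[nullMeasure n d] hermiteTensor α := MemLp.coeFn_toLp _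

theorem inner_hermiteLp (α α' : Fin n → Fin d → ℕ) :
    inner ℝ (hermiteLp α) (hermiteLp α')
      = if α = α' then ∏ μ, ∏ i, ((α μ i).factorial : ℝ) else 0 := by
  rw [L2.inner_def, ← integral_hermiteTensor_mul]
  refine integral_congr_ae ?_
  filter_upwards [coeFn_hermiteLp α, coeFn_hermiteLp α'] with x h1 h2
  rw [h1, h2]
  simp [mul_comm]

theorem eval_hermiteAffine_one_zero (α : Fin n → Fin d → ℕ) (x : Fin n → Fin d → ℝ) :
    MvPolynomial.eval (fun i : Fin n × Fin d => x i.1 i.2) (hermiteAffine 1 0 fun i => α i.1 i.2)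
      = hermiteTensor α x := by
  rw [eval_hermiteAffine, Fintype.prod_prod_type]
  simp [hermiteTensor]

theorem polySubspace_eq_span (D : ℕ) :
    polySubspace (nullMeasure n d) D
      = Submodule.span ℝ (hermiteLp '' (multiIndices n d D : Set (Fin n → Fin d → ℕ))) := by
  apply le_antisymm
  · rintro w ⟨q, hq, hw⟩
    -- The span induction is run on polynomials, carrying along an `L²` class that represents each
    -- one almost everywhere.
    have key : ∀ q ∈ hermiteSpan (Fin n × Fin d) D,
        ∃ v ∈ Submodule.span ℝ (hermiteLp '' (multiIndices n d D : Set (Fin n → Fin d → ℕ))),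
          v =ᵐ[nullMeasure n d] fun x => MvPolynomial.eval (fun i => x i.1 i.2) q := by
      intro q hq
      induction hq using Submodule.span_induction with
      | mem q h =>
        obtain ⟨α, hα, rfl⟩ := h
        refine ⟨hermiteLp fun μ i => α (μ, i), Submodule.subset_span ⟨_, ?_, rfl⟩, ?_⟩
        · rw [Finset.mem_coe, mem_multiIndices, ← Fintype.sum_prod_type']
          exact hα
        · filter_upwards [coeFn_hermiteLp fun μ i => α (μ, i)] with x hx
          rw [hx, ← eval_hermiteAffine_one_zero]
      | zero =>
        refine ⟨0, Submodule.zero_mem _, ?_⟩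
        filter_upwards [Lp.coeFn_zero ℝ 2 (nullMeasure n d)] with x hx
        rw [hx, map_zero, Pi.zero_apply]
      | add q r _ _ hq hr =>
        obtain ⟨v, hv, h1⟩ := hq
        obtain ⟨w, hw, h2⟩ := hr
        refine ⟨v + w, Submodule.add_mem _ hv hw, ?_⟩
        filter_upwards [Lp.coeFn_add v w, h1, h2] with x e1 e2 e3
        rw [e1, Pi.add_apply, e2, e3, map_add]
      | smul c q _ hq =>
        obtain ⟨v, hv, h1⟩ := hq
        refine ⟨c • v, Submodule.smul_mem _ _ hv, ?_⟩
        filter_upwards [Lp.coeFn_smul c v, h1] with x e1 e2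
        rw [e1, Pi.smul_apply, e2, MvPolynomial.smul_eval, smul_eq_mul]
    obtain ⟨v, hv, h⟩ := key q (mem_hermiteSpan hq)
    rwa [Lp.ext (hw.trans h.symm)]
  · rw [Submodule.span_le]
    rintro _ ⟨α, hα, rfl⟩
    refine ⟨hermiteAffine 1 0 fun i => α i.1 i.2, ?_, ?_⟩
    · refine (totalDegree_hermiteAffine_le _).trans ?_
      rw [Fintype.sum_prod_type]
      exact mem_multiIndices.1 hα
    · filter_upwards [coeFn_hermiteLp α] with x hx
      rw [hx, eval_hermiteAffine_one_zero]

/-- The coefficient of the likelihood ratio on `h_α` is `𝔼_P[h_α]`, by the Radon–Nikodym property.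
The finite orthogonal expansion `v` with these coefficients is identified as the projection by
checking that the residual is orthogonal to each `h_α`. -/
theorem norm_sq_ldlr {P : Measure (Fin n → Fin d → ℝ)} [IsFiniteMeasure P] {C : ℝ≥0∞}
    (hC : C ≠ ∞) (hle : P ≤ C • nullMeasure n d) (D : ℕ) :
    ‖ldlr P (nullMeasure n d) D‖ ^ 2
      = ∑ α ∈ multiIndices n d D,
          (∫ x, hermiteTensor α x ∂P) ^ 2 / ∏ μ, ∏ i, ((α μ i).factorial : ℝ) := by
  have hL := memLp_likelihoodRatio hC hle
  rw [ldlr, dif_pos hL]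
  set L := hL.toLp (likelihoodRatio P (nullMeasure n d)) with hLdef
  set N : (Fin n → Fin d → ℕ) → ℝ := fun α => ∏ μ, ∏ i, ((α μ i).factorial : ℝ) with hN
  set c : (Fin n → Fin d → ℕ) → ℝ := fun α => ∫ x, hermiteTensor α x ∂P with hc
  have hN0 : ∀ α, N α ≠ 0 := fun α => Finset.prod_ne_zero_iff.2 fun μ _ =>
    Finset.prod_ne_zero_iff.2 fun i _ => by positivity
  have hinner : ∀ α, inner ℝ L (hermiteLp α) = c α := fun α => by
    rw [L2.inner_def]
    refine Eq.trans ?_ (integral_toReal_rnDeriv_mul (absolutelyContinuous_of_le_smul hle))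
    refine integral_congr_ae ?_
    filter_upwards [hL.coeFn_toLp, coeFn_hermiteLp α] with x h1 h2
    rw [hLdef, h1, h2]
    simp [likelihoodRatio, mul_comm]
  set v : Lp ℝ 2 (nullMeasure n d) := ∑ α ∈ multiIndices n d D, (c α / N α) • hermiteLp α with hv
  have hvin : ∀ α ∈ multiIndices n d D, inner ℝ v (hermiteLp α) = c α := fun α hα => by
    rw [hv, sum_inner, Finset.sum_eq_single_of_mem α hα]
    · rw [inner_smul_left, inner_hermiteLp, if_pos rfl]
      exact div_mul_cancel₀ _ (hN0 α)
    · intro α' _ hne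
      rw [inner_smul_left, inner_hermiteLp, if_neg hne, mul_zero]
  have hproj : (polySubspace (nullMeasure n d) D).starProjection L = v := by
    refine Submodule.eq_starProjection_of_mem_of_inner_eq_zero ?_ ?_
    · rw [polySubspace_eq_span]
      exact Submodule.sum_mem _ fun α hα =>
        Submodule.smul_mem _ _ (Submodule.subset_span ⟨α, hα, rfl⟩)
    · rw [polySubspace_eq_span]
      intro w hw
      induction hw using Submodule.span_induction with
      | mem w h =>
        obtain ⟨α, hα, rfl⟩ := h
        rw [inner_sub_left, hinner, hvin α hα, sub_self]
      | zero => simp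
      | add x y _ _ hx hy => rw [inner_add_right, hx, hy, add_zero]
      | smul a x _ hx => rw [inner_smul_right, hx, mul_zero]
  rw [hproj, ← real_inner_self_eq_norm_sq]
  conv_lhs => rw [hv, inner_sum]
  refine Finset.sum_congr rfl fun α hα => ?_
  rw [inner_smul_right, hvin α hα]
  ring

end Projection

/-! ### Sums over compositions -/

section Composition

variable {ι : Type*} [Fintype ι] [DecidableEq ι]

set_option linter.unusedSectionVars false

/-- The coefficient of `t ^ m` in `(∑ k, φ k * t ^ k) ^ |ι|`. -/
def compositionSum (ι : Type*) [Fintype ι] [DecidableEq ι] (φ : ℕ → ℝ) (m : ℕ) : ℝ :=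
  ∑ k ∈ Finset.piAntidiag (Finset.univ : Finset ι) m, ∏ i, φ (k i)

/-- The multinomial theorem divided by `m!`. -/
theorem sum_prod_pow_div_factorial (s : Finset ι) (f : ι → ℝ) (m : ℕ) :
    ∑ k ∈ Finset.piAntidiag s m, ∏ i ∈ s, f i ^ k i / ((k i).factorial : ℝ)
      = (∑ i ∈ s, f i) ^ m / (m.factorial : ℝ) := by
  rw [Finset.sum_pow_eq_sum_piAntidiag, Finset.sum_div]
  refine Finset.sum_congr rfl fun k hk => ?_
  have h := Nat.multinomial_spec s k
  rw [(Finset.mem_piAntidiag.1 hk).1] at h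
  have h0 : ((∏ i ∈ s, (k i).factorial : ℕ) : ℝ) ≠ 0 := by
    exact_mod_cast Finset.prod_ne_zero_iff.2 fun i _ => Nat.factorial_ne_zero _
  rw [Finset.prod_div_distrib, ← h]
  push_cast at h0 ⊢
  have h1 : (Nat.multinomial s k : ℝ) ≠ 0 := by exact_mod_cast (Nat.multinomial_pos s k).ne'
  field_simp

theorem compositionSum_nonneg {φ : ℕ → ℝ} (hφ : ∀ k, 0 ≤ φ k) (m : ℕ) :
    0 ≤ compositionSum ι φ m :=
  Finset.sum_nonneg fun _ _ => Finset.prod_nonneg fun _ _ => hφ _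

theorem compositionSum_zero {φ : ℕ → ℝ} (h0 : φ 0 = 1) : compositionSum ι φ 0 = 1 := by
  simp [compositionSum, h0]

/-- Keep only the compositions equal to `r` on a set of `j` indices and zero elsewhere; there is one
for each such set. -/
theorem le_compositionSum {φ : ℕ → ℝ} (hφ : ∀ k, 0 ≤ φ k) (h0 : φ 0 = 1) {r : ℕ} (hr : 0 < r)
    (j : ℕ) :
    ((Fintype.card ι).choose j : ℝ) * φ r ^ j ≤ compositionSum ι φ (r * j) := by
  classical
  let e : Finset ι → ι → ℕ := fun A i => if i ∈ A then r else 0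
  have he : Function.Injective e := fun A B h => by
    ext i
    have := congrFun h i
    simp only [e] at this
    by_cases hA : i ∈ A <;> by_cases hB : i ∈ B <;> simp_all
  have hval : ∀ A ∈ Finset.powersetCard j (Finset.univ : Finset ι), ∏ i, φ (e A i) = φ r ^ j := by
    intro A hA
    have : ∀ i, φ (e A i) = if i ∈ A then φ r else 1 := fun i => by
      simp only [e]; split_ifs <;> simp [h0]
    simp only [this]
    rw [Finset.prod_ite_mem, Finset.univ_inter, Finset.prod_const, (Finset.mem_powersetCard.1 hA).2]
  have hsub : (Finset.powersetCard j (Finset.univ : Finset ι)).image e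
      ⊆ Finset.piAntidiag Finset.univ (r * j) := by
    intro k hk
    obtain ⟨A, hA, rfl⟩ := Finset.mem_image.1 hk
    rw [Finset.mem_piAntidiag]
    refine ⟨?_, fun _ _ => Finset.mem_univ _⟩
    simp only [e]
    rw [Finset.sum_ite_mem, Finset.univ_inter, Finset.sum_const, (Finset.mem_powersetCard.1 hA).2,
      smul_eq_mul, mul_comm]
  calc ((Fintype.card ι).choose j : ℝ) * φ r ^ j
      = ∑ A ∈ Finset.powersetCard j (Finset.univ : Finset ι), ∏ i, φ (e A i) := by
        rw [Finset.sum_congr rfl hval, Finset.sum_const, Finset.card_powersetCard, Finset.card_univ,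
          nsmul_eq_mul]
    _ = ∑ k ∈ (Finset.powersetCard j (Finset.univ : Finset ι)).image e, ∏ i, φ (k i) := by
        rw [Finset.sum_image fun A _ B _ h => he h]
    _ ≤ compositionSum ι φ (r * j) :=
        Finset.sum_le_sum_of_subset_of_nonneg hsub fun _ _ _ => Finset.prod_nonneg fun _ _ => hφ _

/-- In a contributing composition every nonzero part is at least `r`, so its support has at most `m
/ r` elements and lies in a set `A` of exactly that size; this is where `hcard` is needed. A union
bound over `A` remains, and for fixed `A` the sum of the inverse factorials is `(m / r)^m / m!`. -/
theorem compositionSum_le {φ : ℕ → ℝ} {r m : ℕ} {B : ℝ} (hB : 0 ≤ B) (hr : 0 < r)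
    (hφ : ∀ k, 0 < k → k < r → φ k = 0) (hcard : m / r ≤ Fintype.card ι)
    (hle : ∀ k : ι → ℕ, ∑ i, k i = m → ∏ i, φ (k i) ≤ B * ∏ i, (((k i).factorial : ℝ))⁻¹) :
    compositionSum ι φ m
      ≤ B * ((Fintype.card ι).choose (m / r) * ((m / r : ℕ) : ℝ) ^ m / (m.factorial : ℝ)) := by
  classical
  set T := Finset.powersetCard (m / r) (Finset.univ : Finset ι) with hT
  set w : (ι → ℕ) → ℝ := fun k => ∏ i, (((k i).factorial : ℝ))⁻¹ with hw
  have hw0 : ∀ k, 0 ≤ w k := fun k => Finset.prod_nonneg fun i _ => by positivity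
  have hcover : ∀ k ∈ Finset.piAntidiag (Finset.univ : Finset ι) m, ∏ i, φ (k i)
      ≤ B * ∑ A ∈ T, if k ∈ Finset.piAntidiag A m then w k else 0 := by
    intro k hk
    have hsum := (Finset.mem_piAntidiag.1 hk).1
    by_cases hz : ∃ i, 0 < k i ∧ k i < r
    · obtain ⟨i, h1, h2⟩ := hz
      rw [Finset.prod_eq_zero (Finset.mem_univ i) (hφ _ h1 h2)]
      exact mul_nonneg hB (Finset.sum_nonneg fun A _ => by split_ifs; exacts [hw0 k, le_rfl])
    · push Not at hz
      have hs : (Finset.univ.filter fun i => k i ≠ 0).card ≤ m / r := by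
        rw [Nat.le_div_iff_mul_le hr, ← hsum, ← smul_eq_mul]
        refine (Finset.card_nsmul_le_sum _ k r fun i hi => ?_).trans
          (Finset.sum_le_univ_sum_of_nonneg fun _ => zero_le)
        exact hz i (Nat.pos_of_ne_zero (Finset.mem_filter.1 hi).2)
      obtain ⟨A, hA1, hA2, hA3⟩ := Finset.exists_subsuperset_card_eq
        (Finset.subset_univ (Finset.univ.filter fun i => k i ≠ 0)) hs
        (by rwa [Finset.card_univ])
      have hmem : k ∈ Finset.piAntidiag A m := by
        rw [Finset.mem_piAntidiag]
        refine ⟨?_, fun i hi => hA1 (by simpa using hi)⟩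
        rw [← hsum]
        refine Finset.sum_subset (Finset.subset_univ A) fun i _ hi => ?_
        by_contra h
        exact hi (hA1 (by simpa using h))
      refine (hle k hsum).trans (mul_le_mul_of_nonneg_left ?_ hB)
      refine le_trans ?_ (Finset.single_le_sum (f := fun A => if k ∈ Finset.piAntidiag A m
        then w k else 0) (fun A _ => by split_ifs; exacts [hw0 k, le_rfl])
        (Finset.mem_powersetCard.2 ⟨Finset.subset_univ A, hA3⟩))
      rw [if_pos hmem]
  have hinner : ∀ A ∈ T, ∑ k ∈ Finset.piAntidiag (Finset.univ : Finset ι) m,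
      (if k ∈ Finset.piAntidiag A m then w k else 0) = ((m / r : ℕ) : ℝ) ^ m / m.factorial := by
    intro A hA
    have hsub : Finset.piAntidiag A m ⊆ Finset.piAntidiag (Finset.univ : Finset ι) m := by
      intro k hk
      rw [Finset.mem_piAntidiag] at hk ⊢
      refine ⟨?_, fun _ _ => Finset.mem_univ _⟩
      rw [← hk.1]
      refine (Finset.sum_subset (Finset.subset_univ A) fun i _ hi => ?_).symm
      by_contra h
      exact hi (hk.2 i h)
    have h2 := sum_prod_pow_div_factorial A (fun _ => (1 : ℝ)) m
    rw [Finset.sum_const, (Finset.mem_powersetCard.1 hA).2, nsmul_eq_mul, mul_one] at h2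
    rw [← h2, Finset.sum_ite_mem, Finset.inter_eq_right.2 hsub]
    refine Finset.sum_congr rfl fun k hk => ?_
    simp only [hw, one_pow, one_div]
    refine (Finset.prod_subset (Finset.subset_univ A) fun i _ hi => ?_).symm
    have : k i = 0 := by
      by_contra h
      exact hi ((Finset.mem_piAntidiag.1 hk).2 i h)
    simp [this]
  calc compositionSum ι φ m
      ≤ ∑ k ∈ Finset.piAntidiag (Finset.univ : Finset ι) m,
          B * ∑ A ∈ T, (if k ∈ Finset.piAntidiag A m then w k else 0) := Finset.sum_le_sum hcover
    _ = B * ∑ A ∈ T, ((m / r : ℕ) : ℝ) ^ m / m.factorial := by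
        rw [← Finset.mul_sum, Finset.sum_comm, Finset.sum_congr rfl hinner]
    _ = _ := by
        rw [Finset.sum_const, hT, Finset.card_powersetCard, Finset.card_univ, nsmul_eq_mul,
          mul_div_assoc]

end Composition

/-! ### Moments of a sum of independent signs -/

section SignMoment

/-- The weight of a column sum: `1 / k!` for even `k` and `0` for odd `k`. -/
def evenWeight (k : ℕ) : ℝ := if Even k then ((k.factorial : ℝ))⁻¹ else 0

theorem evenWeight_nonneg (k : ℕ) : 0 ≤ evenWeight k := by
  unfold evenWeight; split_ifs <;> positivity

theorem pow_sum_eq (d m : ℕ) (u : Fin d → ℝ) :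
    (∑ i, u i) ^ m = ∑ γ ∈ Finset.piAntidiag (Finset.univ : Finset (Fin d)) m,
      ((m.factorial : ℝ) * ∏ i, (((γ i).factorial : ℝ))⁻¹) * ∏ i, u i ^ γ i := by
  have h := sum_prod_pow_div_factorial Finset.univ u m
  rw [eq_div_iff (by positivity)] at h
  rw [← h, Finset.sum_mul]
  refine Finset.sum_congr rfl fun γ _ => ?_
  simp only [div_eq_mul_inv, Finset.prod_mul_distrib]
  ring

theorem integrable_pow_sum_rademacher (d m : ℕ) :
    Integrable (fun u => (∑ i, u i) ^ m) (Measure.pi fun _ : Fin d => rademacher) := by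
  simp only [pow_sum_eq]
  exact integrable_finsetSum _ fun γ _ => (integrable_prod_pow_rademacher γ).const_mul _

theorem integral_pow_sum_rademacher (d m : ℕ) :
    ∫ u, (∑ i, u i) ^ m ∂(Measure.pi fun _ : Fin d => rademacher)
      = m.factorial * compositionSum (Fin d) evenWeight m := by
  simp only [pow_sum_eq]
  rw [integral_finsetSum _ fun γ _ => (integrable_prod_pow_rademacher γ).const_mul _,
    compositionSum, Finset.mul_sum]
  refine Finset.sum_congr rfl fun γ _ => ?_
  rw [integral_const_mul, integral_prod_pow_rademacher, mul_assoc, ← Finset.prod_mul_distrib]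
  congr 1
  refine Finset.prod_congr rfl fun i _ => ?_
  simp [evenWeight]

/-- Keep the monomials that are squares of products of `k` distinct signs; each has multinomial
coefficient `(2k)! / 2^k`. -/
theorem choose_mul_le_integral_pow_sum (d k : ℕ) :
    (d.choose k : ℝ) * ((2 * k).factorial / 2 ^ k)
      ≤ ∫ u, (∑ i, u i) ^ (2 * k) ∂(Measure.pi fun _ : Fin d => rademacher) := by
  have h := le_compositionSum (ι := Fin d) evenWeight_nonneg (by simp [evenWeight]) two_pos k
  rw [Fintype.card_fin] at h
  have h2 : evenWeight 2 = 2⁻¹ := by simp [evenWeight]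
  rw [integral_pow_sum_rademacher]
  calc (d.choose k : ℝ) * ((2 * k).factorial / 2 ^ k)
      = (2 * k).factorial * (d.choose k * evenWeight 2 ^ k) := by
        rw [h2, inv_pow]; ring
    _ ≤ _ := by gcongr

/-- Jensen's inequality for `x ↦ x^{2m}` applied to `(∑ u i)²`. It holds for all `d` and `m`, unlike
the sharper bound `pow_le_choose_mul_factorial` used in the asymptotic regime. -/
theorem pow_le_integral_pow_sum (d m : ℕ) :
    (d : ℝ) ^ (2 * m)
      ≤ ∫ u, (∑ i, u i) ^ (4 * m) ∂(Measure.pi fun _ : Fin d => rademacher) := by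
  have h1 : (d : ℝ) ≤ ∫ u, (∑ i, u i) ^ 2 ∂(Measure.pi fun _ : Fin d => rademacher) := by
    simpa using choose_mul_le_integral_pow_sum d 1
  have h2 := (convexOn_pow (𝕜 := ℝ) (2 * m)).map_integral_le (by fun_prop) isClosed_Ici
    (μ := Measure.pi fun _ : Fin d => rademacher) (f := fun u => (∑ i, u i) ^ 2)
    (.of_forall fun u => Set.mem_Ici.2 (sq_nonneg _)) (integrable_pow_sum_rademacher d 2)
    (by
      refine (integrable_pow_sum_rademacher d (2 * (2 * m))).congr (.of_forall fun u => ?_)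
      simp only [Function.comp]
      rw [pow_mul])
  calc (d : ℝ) ^ (2 * m)
      ≤ (∫ u, (∑ i, u i) ^ 2 ∂(Measure.pi fun _ : Fin d => rademacher)) ^ (2 * m) := by gcongr
    _ ≤ _ := h2
    _ = _ := by
        refine integral_congr_ae (.of_forall fun u => ?_)
        simp only []
        rw [← pow_mul]; ring_nf

end SignMoment

/-! ### The norm in terms of row and column sums -/

section Norm

variable {β : ℝ} {p : Measure ℝ}

/-- The weight of a row sum: `(β / (1 + β)) ^ k * 𝔼[h_k(g)]² / k!`. -/
def rowWeight (β : ℝ) (p : Measure ℝ) (k : ℕ) : ℝ :=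
  (β / (1 + β)) ^ k * hermiteCoeff p k ^ 2 / (k.factorial : ℝ)

theorem rowWeight_nonneg (hβ : 0 < β) (k : ℕ) : 0 ≤ rowWeight β p k := by
  unfold rowWeight; positivity

theorem rowWeight_zero [IsProbabilityMeasure p] : rowWeight β p 0 = 1 := by
  simp [rowWeight, hermiteCoeff_zero]

theorem sum_multiIndices (n d D : ℕ) (F : (Fin n → Fin d → ℕ) → ℝ) :
    ∑ α ∈ multiIndices n d D, F α
      = ∑ m ∈ Finset.range (D + 1), ∑ k ∈ Finset.piAntidiag (Finset.univ : Finset (Fin n)) m,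
          ∑ α ∈ Fintype.piFinset fun μ => Finset.piAntidiag (Finset.univ : Finset (Fin d)) (k μ),
            F α := by
  rw [← Finset.sum_fiberwise_of_maps_to (s := multiIndices n d D) (t := Finset.range (D + 1))
    (g := fun α => ∑ μ, ∑ i, α μ i)
    fun α hα => Finset.mem_range.2 (Nat.lt_succ_of_le (mem_multiIndices.1 hα))]
  refine Finset.sum_congr rfl fun m hm => ?_
  rw [← Finset.sum_fiberwise_of_maps_to (t := Finset.piAntidiag (Finset.univ : Finset (Fin n)) m)
    (g := fun α μ => ∑ i, α μ i) fun α hα => by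
      simpa [Finset.mem_piAntidiag] using (Finset.mem_filter.1 hα).2]
  refine Finset.sum_congr rfl fun k hk => Finset.sum_congr ?_ fun _ _ => rfl
  ext α
  have hk1 := (Finset.mem_piAntidiag.1 hk).1
  have hm1 := Finset.mem_range.1 hm
  simp only [Finset.mem_filter, mem_multiIndices, Fintype.mem_piFinset, Finset.mem_piAntidiag,
    Finset.mem_univ, implies_true, and_true, funext_iff]
  refine ⟨fun h => h.2, fun h => ⟨?_, h⟩⟩
  simp only [h, hk1, and_true]
  omega

/-- The parity condition couples the rows, but once the row sums are fixed, summing over `α` leaves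
a sign moment that depends on them only through their total `m`. What remains is a product over
rows. -/
theorem norm_sq_eq (hβ : 0 < β) [IsProbabilityMeasure p]
    (hp : Integrable (fun x : ℝ => Real.exp (x ^ 2 / 2)) p) (n : ℕ) {d : ℕ} (hd : 0 < d) (D : ℕ) :
    ldlrNorm β p n d D ^ 2
      = ∑ m ∈ Finset.range (D + 1),
          (∫ u, (∑ i, u i) ^ m ∂(Measure.pi fun _ : Fin d => rademacher)) / (d : ℝ) ^ m
            * compositionSum (Fin n) (rowWeight β p) m := by
  obtain ⟨C, hC, hle⟩ := spikedMeasure_le hβ hp n hd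
  have hd' : (0 : ℝ) < d := by exact_mod_cast hd
  rw [ldlrNorm, norm_sq_ldlr hC hle, sum_multiIndices]
  refine Finset.sum_congr rfl fun m _ => ?_
  rw [compositionSum, Finset.mul_sum]
  refine Finset.sum_congr rfl fun k hk => ?_
  have hk1 := (Finset.mem_piAntidiag.1 hk).1
  -- Expand `(∑ u i)^{k μ} / (k μ)!` for each row by the multinomial theorem, multiply over the
  -- rows, and take the expectation: the parity indicators appear.
  have hX : (∫ u, (∑ i, u i) ^ m ∂(Measure.pi fun _ : Fin d => rademacher))
        / ∏ μ, ((k μ).factorial : ℝ)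
      = ∑ α ∈ Fintype.piFinset fun μ => Finset.piAntidiag (Finset.univ : Finset (Fin d)) (k μ),
          (∏ i, if Even (∑ μ, α μ i) then (1 : ℝ) else 0)
            * (∏ μ, ∏ i, ((α μ i).factorial : ℝ))⁻¹ := by
    have h1 : ∀ u : Fin d → ℝ, (∑ i, u i) ^ m / ∏ μ, ((k μ).factorial : ℝ)
        = ∑ α ∈ Fintype.piFinset fun μ => Finset.piAntidiag (Finset.univ : Finset (Fin d)) (k μ),
          (∏ i, u i ^ ∑ μ, α μ i) * (∏ μ, ∏ i, ((α μ i).factorial : ℝ))⁻¹ := by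
      intro u
      rw [← hk1, ← Finset.prod_pow_eq_pow_sum, ← Finset.prod_div_distrib]
      simp only [← sum_prod_pow_div_factorial]
      rw [Finset.prod_univ_sum]
      refine Finset.sum_congr rfl fun α _ => ?_
      simp only [Finset.prod_div_distrib, ← Finset.prod_pow_eq_pow_sum]
      rw [Finset.prod_comm, div_eq_mul_inv]
    rw [← integral_div]
    simp only [h1]
    rw [integral_finsetSum _ fun α _ => (integrable_prod_pow_rademacher _).mul_const _]
    simp only [integral_mul_const, integral_prod_pow_rademacher]
  have hw : ∏ μ, rowWeight β p (k μ)
      = (∏ μ, (β / (1 + β)) ^ k μ * hermiteCoeff p (k μ) ^ 2) / ∏ μ, ((k μ).factorial : ℝ) := by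
    simp only [rowWeight, Finset.prod_div_distrib]
  have hdm : (d : ℝ) ^ m = ∏ μ, (d : ℝ) ^ k μ := by rw [Finset.prod_pow_eq_pow_sum, hk1]
  have e : ∀ x : ℝ, x / (d : ℝ) ^ m * ∏ μ, rowWeight β p (k μ)
      = (∏ μ, (β / (1 + β)) ^ k μ * hermiteCoeff p (k μ) ^ 2 / (d : ℝ) ^ k μ)
        * (x / ∏ μ, ((k μ).factorial : ℝ)) := fun x => by
    rw [hw, Finset.prod_div_distrib (g := fun μ => (d : ℝ) ^ k μ), ← hdm]; ring
  rw [e, hX, Finset.mul_sum]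
  refine Finset.sum_congr rfl fun α hα => ?_
  have hα1 : ∀ μ, ∑ i, α μ i = k μ := fun μ =>
    (Finset.mem_piAntidiag.1 (Fintype.mem_piFinset.1 hα μ)).1
  rw [integral_hermiteTensor_spikedMeasure hβ hp hd]
  simp only [hα1]
  rw [mul_pow, ← Finset.prod_pow, ← Finset.prod_pow, div_eq_mul_inv, mul_assoc]
  congr 1
  · refine Finset.prod_congr rfl fun μ _ => ?_
    rw [div_pow, mul_pow, ← pow_mul, ← pow_mul, mul_comm (k μ), pow_mul, pow_mul,
      sq_latentWeight hβ, Real.sq_sqrt hd'.le]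
  · congr 1
    refine Finset.prod_congr rfl fun i _ => ?_
    split_ifs <;> simp

end Norm

/-! ### Bounds at fixed dimension -/

section Bounds

variable {β : ℝ} {p : Measure ℝ} [IsProbabilityMeasure p] {Λ : ℝ}

/-- The contribution of the polynomials of degree exactly `m` to the squared norm. -/
def degreeTerm (β : ℝ) (p : Measure ℝ) (n d m : ℕ) : ℝ :=
  (∫ u, (∑ i, u i) ^ m ∂(Measure.pi fun _ : Fin d => rademacher)) / (d : ℝ) ^ m
    * compositionSum (Fin n) (rowWeight β p) m

omit [IsProbabilityMeasure p] in
theorem degreeTerm_nonneg (hβ : 0 < β) (n d m : ℕ) : 0 ≤ degreeTerm β p n d m := by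
  unfold degreeTerm
  rw [integral_pow_sum_rademacher]
  have h1 := compositionSum_nonneg (ι := Fin d) evenWeight_nonneg m
  have h2 := compositionSum_nonneg (ι := Fin n) (rowWeight_nonneg (p := p) hβ) m
  positivity

theorem degreeTerm_zero (n d : ℕ) : degreeTerm β p n d 0 = 1 := by
  simp [degreeTerm, compositionSum_zero rowWeight_zero]

theorem norm_sq_eq_sum_degreeTerm (hβ : 0 < β) (hp : LatentAssumption p Λ) (n : ℕ) {d : ℕ}
    (hd : 0 < d) (D : ℕ) :
    ldlrNorm β p n d D ^ 2 = ∑ m ∈ Finset.range (D + 1), degreeTerm β p n d m :=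
  norm_sq_eq hβ hp.exp_integrable n hd D

theorem norm_sq_eq_one_add (hβ : 0 < β) (hp : LatentAssumption p Λ) (n : ℕ) {d : ℕ}
    (hd : 0 < d) (D : ℕ) :
    ldlrNorm β p n d D ^ 2 = 1 + ∑ m ∈ Finset.Icc 1 D, degreeTerm β p n d m := by
  rw [norm_sq_eq_sum_degreeTerm hβ hp n hd, Finset.sum_range_eq_add_Ico _ (Nat.succ_pos D),
    degreeTerm_zero]
  rfl

theorem degreeTerm_le_norm_sq (hβ : 0 < β) (hp : LatentAssumption p Λ) (n : ℕ) {d : ℕ}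
    (hd : 0 < d) {m D : ℕ} (hm : m ≤ D) : degreeTerm β p n d m ≤ ldlrNorm β p n d D ^ 2 := by
  rw [norm_sq_eq_sum_degreeTerm hβ hp n hd]
  exact Finset.single_le_sum (fun k _ => degreeTerm_nonneg hβ n d k)
    (Finset.mem_range.2 (Nat.lt_succ_of_le hm))

theorem one_le_norm_sq (hβ : 0 < β) (hp : LatentAssumption p Λ) (n : ℕ) {d : ℕ}
    (hd : 0 < d) (D : ℕ) : 1 ≤ ldlrNorm β p n d D ^ 2 := by
  simpa [degreeTerm_zero] using degreeTerm_le_norm_sq hβ hp n hd (Nat.zero_le D)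

theorem rowWeight_four (hp : LatentAssumption p Λ) :
    rowWeight β p 4 = (β / (1 + β)) ^ 4 * kappa4 p ^ 2 / 24 := by
  rw [rowWeight, hermiteCoeff_four hp]
  norm_num [Nat.factorial]

/-- Only the configurations with `m` rows of sum four are kept. The moment bound `B` is left free,
since the two lower bounds insert different ones. -/
theorem degreeTerm_four_mul_ge (hβ : 0 < β) (hp : LatentAssumption p Λ) (n d m : ℕ) {B : ℝ}
    (hB : B ≤ ∫ u, (∑ i, u i) ^ (4 * m) ∂(Measure.pi fun _ : Fin d => rademacher)) :
    B / (d : ℝ) ^ (4 * m) * (n.choose m * ((β / (1 + β)) ^ 4 * kappa4 p ^ 2 / 24) ^ m)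
      ≤ degreeTerm β p n d (4 * m) := by
  have h := le_compositionSum (ι := Fin n) (rowWeight_nonneg (p := p) hβ) rowWeight_zero
    (by norm_num : 0 < 4) m
  rw [Fintype.card_fin, rowWeight_four hp] at h
  have h1 := compositionSum_nonneg (ι := Fin d) evenWeight_nonneg (4 * m)
  have h0 : 0 ≤ ∫ u, (∑ i, u i) ^ (4 * m) ∂(Measure.pi fun _ : Fin d => rademacher) := by
    rw [integral_pow_sum_rademacher]; positivity
  unfold degreeTerm
  gcongr

theorem lower_bound (hβ : 0 < β) (hp : LatentAssumption p Λ) (n : ℕ) {d : ℕ} (hd : 0 < d) (D : ℕ) :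
    ∑ m ∈ Finset.range (D / 4 + 1), (n.choose m : ℝ) * ((d + 1).choose 2 : ℝ) ^ m *
          (β ^ 2 * kappa4 p / (√24 * (d : ℝ) ^ 2 * (1 + β) ^ 2)) ^ (2 * m)
        ≤ ldlrNorm β p n d D ^ 2 := by
  have hd' : (0 : ℝ) < d := by exact_mod_cast hd
  have hd1 : (1 : ℝ) ≤ d := by exact_mod_cast hd
  have hterm : ∀ m, (n.choose m : ℝ) * ((d + 1).choose 2 : ℝ) ^ m *
      (β ^ 2 * kappa4 p / (√24 * (d : ℝ) ^ 2 * (1 + β) ^ 2)) ^ (2 * m)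
      ≤ degreeTerm β p n d (4 * m) := by
    intro m
    refine le_trans ?_ (degreeTerm_four_mul_ge hβ hp n d m (pow_le_integral_pow_sum d m))
    have h24 : √(24 : ℝ) ^ 2 = 24 := Real.sq_sqrt (by norm_num)
    have e1 : (β ^ 2 * kappa4 p / (√24 * (d : ℝ) ^ 2 * (1 + β) ^ 2)) ^ 2
        = (β / (1 + β)) ^ 4 * kappa4 p ^ 2 / 24 / (d : ℝ) ^ 4 := by
      rw [div_pow, mul_pow, mul_pow, mul_pow, h24]
      field_simp
    -- The binomial is `d (d + 1) / 2`, hence at most `d²` for `d ≥ 1`, and the Jensen bound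
    -- suffices.
    have e2 : ((d + 1).choose 2 : ℝ) ≤ (d : ℝ) ^ 2 := by
      rw [Nat.cast_choose_two]
      push_cast
      nlinarith
    rw [pow_mul, e1]
    have e3 : (d : ℝ) ^ (2 * m) / (d : ℝ) ^ (4 * m)
        * (n.choose m * ((β / (1 + β)) ^ 4 * kappa4 p ^ 2 / 24) ^ m)
        = n.choose m * ((d : ℝ) ^ 2) ^ m
          * ((β / (1 + β)) ^ 4 * kappa4 p ^ 2 / 24 / (d : ℝ) ^ 4) ^ m := by
      rw [pow_mul, pow_mul, div_pow _ ((d : ℝ) ^ 4)]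
      ring
    rw [e3]
    gcongr
  refine (Finset.sum_le_sum fun m _ => hterm m).trans ?_
  rw [norm_sq_eq_sum_degreeTerm hβ hp n hd,
    ← Finset.sum_image (f := degreeTerm β p n d) (g := fun m => 4 * m)
      fun a _ b _ h => by simpa using h]
  refine Finset.sum_le_sum_of_subset_of_nonneg ?_ fun m _ _ => degreeTerm_nonneg hβ n d m
  intro k hk
  obtain ⟨m, hm, rfl⟩ := Finset.mem_image.1 hk
  have := Finset.mem_range.1 hm
  exact Finset.mem_range.2 (by omega)

/-- Apply `compositionSum_le` to columns with `r = 2`, as odd column sums have weight zero, and to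
rows with `r = 4`. The factor `m!` of the sign moment cancels one of the two resulting inverse
factorials. The bound `S` on products of coefficients is left free for two later choices. -/
theorem degreeTerm_le (hβ : 0 < β) (hp : LatentAssumption p Λ) {n d m : ℕ} (hn : m / 4 ≤ n)
    (hd : m / 2 ≤ d) {S : ℝ} (hS : 0 ≤ S)
    (hle : ∀ k : Fin n → ℕ, ∑ μ, k μ = m → ∏ μ, hermiteCoeff p (k μ) ^ 2 ≤ S) :
    degreeTerm β p n d m
      ≤ (β / (1 + β)) ^ m / (d : ℝ) ^ m * S * n.choose (m / 4) * d.choose (m / 2)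
        * ((m / 4 * (m / 2) : ℕ) ^ m / (m.factorial : ℝ)) := by
  have h1 : compositionSum (Fin d) evenWeight m
      ≤ 1 * (d.choose (m / 2) * ((m / 2 : ℕ) : ℝ) ^ m / (m.factorial : ℝ)) := by
    have := compositionSum_le (ι := Fin d) (φ := evenWeight) (r := 2) (m := m) zero_le_one two_pos
      (fun k h0 h2 => by
        obtain rfl : k = 1 := by omega
        simp [evenWeight]) (by rwa [Fintype.card_fin])
      (fun k _ => by
        rw [one_mul]
        refine Finset.prod_le_prod (fun _ _ => evenWeight_nonneg _) fun i _ => ?_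
        unfold evenWeight
        split_ifs
        exacts [le_rfl, by positivity])
    rwa [Fintype.card_fin] at this
  have h2 : compositionSum (Fin n) (rowWeight β p) m
      ≤ ((β / (1 + β)) ^ m * S)
        * (n.choose (m / 4) * ((m / 4 : ℕ) : ℝ) ^ m / (m.factorial : ℝ)) := by
    have := compositionSum_le (ι := Fin n) (φ := rowWeight β p) (r := 4) (m := m)
      (B := (β / (1 + β)) ^ m * S) (by positivity) (by norm_num)
      (fun k h0 h4 => by
        have : hermiteCoeff p k = 0 := by
          obtain rfl | rfl | rfl : k = 1 ∨ k = 2 ∨ k = 3 := by omega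
          · exact hermiteCoeff_of_odd hp (by decide)
          · exact hermiteCoeff_two hp
          · exact hermiteCoeff_of_odd hp (by decide)
        simp [rowWeight, this]) (by rwa [Fintype.card_fin])
      (fun k hk => by
        simp only [rowWeight, div_eq_mul_inv _ ((Nat.factorial _ : ℕ) : ℝ),
          Finset.prod_mul_distrib, Finset.prod_pow_eq_pow_sum, hk]
        gcongr
        exact hle k hk)
    rwa [Fintype.card_fin] at this
  have h3 := compositionSum_nonneg (ι := Fin n) (rowWeight_nonneg (p := p) hβ) m
  rw [one_mul] at h1
  rw [degreeTerm, integral_pow_sum_rademacher]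
  calc m.factorial * compositionSum (Fin d) evenWeight m / (d : ℝ) ^ m
        * compositionSum (Fin n) (rowWeight β p) m
      ≤ m.factorial * (d.choose (m / 2) * ((m / 2 : ℕ) : ℝ) ^ m / (m.factorial : ℝ)) / (d : ℝ) ^ m
        * (((β / (1 + β)) ^ m * S)
          * (n.choose (m / 4) * ((m / 4 : ℕ) : ℝ) ^ m / (m.factorial : ℝ))) := by gcongr
    _ = _ := by
        have : (m.factorial : ℝ) ≠ 0 := by positivity
        push_cast
        rw [mul_pow]
        field_simp

omit [IsProbabilityMeasure p] in
theorem hermiteSup_nonneg (m : ℕ) : 0 ≤ hermiteSup p m :=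
  Real.iSup_nonneg fun _ => by positivity

/-- By definition of the supremum `H`, the squared coefficient of order `k i` is at most `H^{k i /
m}`, also when `k i = 0`; these exponents add up to one. -/
theorem prod_sq_hermiteCoeff_le_hermiteSup {ι : Type*} [Fintype ι] {m : ℕ} (hm : 0 < m) (k : ι → ℕ)
    (hk : ∑ i, k i = m) : ∏ i, hermiteCoeff p (k i) ^ 2 ≤ hermiteSup p m := by
  have hm' : (0 : ℝ) < m := by exact_mod_cast hm
  have hH := hermiteSup_nonneg (p := p) m
  have h1 : ∀ i, hermiteCoeff p (k i) ^ 2 ≤ hermiteSup p m ^ ((k i : ℝ) / m) := by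
    intro i
    rcases Nat.eq_zero_or_pos (k i) with h0 | hpos
    · simp [h0, hermiteCoeff_zero]
    · have hle : k i ≤ m := by
        rw [← hk]; exact Finset.single_le_sum (fun _ _ => zero_le) (Finset.mem_univ i)
      have hpos' : (0 : ℝ) < k i := by exact_mod_cast hpos
      have h2 : (hermiteCoeff p (k i) ^ 2) ^ ((m : ℝ) / (k i : ℝ)) ≤ hermiteSup p m :=
        le_ciSup (f := fun k : Set.Icc 1 m =>
          (hermiteCoeff p (k : ℕ) ^ 2) ^ ((m : ℝ) / ((k : ℕ) : ℝ)))
          (Set.finite_range _).bddAbove ⟨k i, hpos, hle⟩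
      calc hermiteCoeff p (k i) ^ 2
          = ((hermiteCoeff p (k i) ^ 2) ^ ((m : ℝ) / (k i : ℝ))) ^ ((k i : ℝ) / m) := by
            rw [← Real.rpow_mul (sq_nonneg _), div_mul_div_cancel₀ hpos'.ne', div_self hm'.ne',
              Real.rpow_one]
        _ ≤ _ := by gcongr
  calc ∏ i, hermiteCoeff p (k i) ^ 2 ≤ ∏ i, hermiteSup p m ^ ((k i : ℝ) / m) :=
        Finset.prod_le_prod (fun _ _ => sq_nonneg _) fun i _ => h1 i
    _ = hermiteSup p m ^ (∑ i, (k i : ℝ) / m) :=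
        (Real.rpow_sum_of_nonneg hH fun i _ => by positivity).symm
    _ = hermiteSup p m := by
        rw [← Finset.sum_div, ← Nat.cast_sum, hk, div_self hm'.ne', Real.rpow_one]

theorem upper_bound (hβ : 0 < β) (hp : LatentAssumption p Λ) {n d D : ℕ} (hd : 0 < d)
    (hnD : D / 4 ≤ n) (hdD : D / 2 ≤ d) :
    ldlrNorm β p n d D ^ 2 ≤
        1 + ∑ m ∈ Finset.Icc 1 D, upperCoeff β m / (d : ℝ) ^ m * hermiteSup p m *
          (n.choose (m / 4) : ℝ) * (d.choose (m / 2) : ℝ) := by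
  rw [norm_sq_eq_one_add hβ hp n hd]
  gcongr with m hm
  obtain ⟨hm1, hmD⟩ := Finset.mem_Icc.1 hm
  have hH := hermiteSup_nonneg (p := p) m
  refine (degreeTerm_le hβ hp (by omega) (by omega) hH
    fun k hk => prod_sq_hermiteCoeff_le_hermiteSup hm1 k hk).trans ?_
  -- With `N = ⌊m/4⌋ ⌊m/2⌋`, compare `N^m` with the rising factorial `N (N + 1) ⋯ (N + m - 1)`.
  have hc : ((m / 4 * (m / 2) : ℕ) : ℝ) ^ m / (m.factorial : ℝ)
      ≤ ((m / 4 * (m / 2) + m - 1).choose m : ℝ) := by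
    rw [div_le_iff₀ (by positivity)]
    have h1 : (m / 4 * (m / 2)) ^ m ≤ (m / 4 * (m / 2) + m - 1).choose m * m.factorial := by
      rw [mul_comm _ m.factorial, ← Nat.ascFactorial_eq_factorial_mul_choose']
      exact Nat.pow_succ_le_ascFactorial _ _
    exact_mod_cast h1
  rw [upperCoeff]
  calc (β / (1 + β)) ^ m / (d : ℝ) ^ m * hermiteSup p m * n.choose (m / 4) * d.choose (m / 2)
        * ((m / 4 * (m / 2) : ℕ) ^ m / (m.factorial : ℝ))
      ≤ (β / (1 + β)) ^ m / (d : ℝ) ^ m * hermiteSup p m * n.choose (m / 4) * d.choose (m / 2)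
        * ((m / 4 * (m / 2) + m - 1).choose m : ℝ) := by gcongr
    _ = _ := by ring

end Bounds

/-! ### Elementary estimates -/

/-- Compare descending factorials factor by factor: `n (q - i) ≤ q (n - i)` because `q ≤ n`. -/
theorem pow_le_pow_mul_choose {n q : ℕ} (hq : q ≤ n) : n ^ q ≤ q ^ q * n.choose q := by
  have h : n ^ q * q.descFactorial q ≤ q ^ q * n.descFactorial q := by
    rw [Nat.descFactorial_eq_prod_range, Nat.descFactorial_eq_prod_range, ← Finset.card_range q,
      ← Finset.prod_const, ← Finset.prod_const, Finset.card_range, ← Finset.prod_mul_distrib,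
      ← Finset.prod_mul_distrib]
    refine Finset.prod_le_prod' fun i hi => ?_
    have hi' := Finset.mem_range.1 hi
    rw [Nat.mul_sub, Nat.mul_sub, mul_comm n q]
    exact Nat.sub_le_sub_left (Nat.mul_le_mul_right i hq) _
  rw [Nat.descFactorial_self, Nat.descFactorial_eq_factorial_mul_choose, ← mul_assoc,
    mul_right_comm] at h
  exact Nat.le_of_mul_le_mul_right h q.factorial_pos

theorem div_pow_le_choose {n q : ℕ} (hq : q ≤ n) : ((n : ℝ) / q) ^ q ≤ n.choose q := by
  rcases Nat.eq_zero_or_pos q with rfl | h0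
  · simp
  rw [div_pow, div_le_iff₀ (by positivity), mul_comm]
  exact_mod_cast pow_le_pow_mul_choose hq

/-- Combine `C(d, 2q) ≥ (d / 2q)^{2q}` with `(4q)! ≥ (4q / e)^{4q}` and `e⁴ ≤ 55`: the right side is
at least `(16 q² d² / 55)^q`. The value 10 is the least `q` with `16 q² / 55 ≥ 24`. The gained
factor `24^q` will cancel the `4!` in the weight of a row of sum four. -/
theorem pow_le_choose_mul_factorial {d q : ℕ} (hq : 10 ≤ q) (hd : 2 * q ≤ d) :
    24 ^ q * (d : ℝ) ^ (2 * q) ≤ d.choose (2 * q) * ((4 * q).factorial / 2 ^ (2 * q)) := by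
  have hq' : (10 : ℝ) ≤ q := by exact_mod_cast hq
  have hq0 : (0 : ℝ) < q := by linarith
  have h1 := div_pow_le_choose hd
  have he : Real.exp ((4 * q : ℕ) : ℝ) ≤ 55 ^ q := by
    have h2 : Real.exp 1 ^ 4 ≤ 55 := by
      calc Real.exp 1 ^ 4 ≤ 2.7182818286 ^ 4 := by
            gcongr; exact Real.exp_one_lt_d9.le
        _ ≤ 55 := by norm_num
    calc Real.exp ((4 * q : ℕ) : ℝ) = (Real.exp 1 ^ 4) ^ q := by
          rw [← pow_mul, ← Real.exp_nat_mul, mul_one]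
      _ ≤ 55 ^ q := by gcongr
  have h3 := Real.pow_div_factorial_le_exp (x := ((4 * q : ℕ) : ℝ)) (by positivity) (4 * q)
  have h4 : ((4 * q : ℕ) : ℝ) ^ (4 * q) / 55 ^ q ≤ (4 * q).factorial := by
    rw [div_le_iff₀ (by positivity)]
    rw [div_le_iff₀ (by positivity)] at h3
    calc _ ≤ _ := h3
      _ ≤ _ := by rw [mul_comm]; gcongr
  calc 24 ^ q * (d : ℝ) ^ (2 * q)
      ≤ (16 * (q : ℝ) ^ 2 / 55) ^ q * (d : ℝ) ^ (2 * q) := by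
        gcongr
        nlinarith
    _ = ((d : ℝ) / (2 * q : ℕ)) ^ (2 * q)
          * (((4 * q : ℕ) : ℝ) ^ (4 * q) / 55 ^ q / 2 ^ (2 * q)) := by
        push_cast
        rw [pow_mul (d : ℝ), pow_mul ((d : ℝ) / _), pow_mul (4 * (q : ℝ)), pow_mul (2 : ℝ),
          ← div_pow, ← div_pow, ← mul_pow, ← mul_pow]
        congr 1
        field_simp
        ring
    _ ≤ _ := by gcongr

/-- For large `m` the extra factor `m` beats `K / c`. The finitely many small `m` are absorbed by
two terms on the right: the linear term `m = 1`, which has no counterpart on the left, when `σ` is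
small, and the top term `m = D` when `σ` is large. This makes the threshold on `D` uniform in `σ`.
-/
theorem exists_sum_le_sum {K c : ℝ} (hK : 0 < K) (hc : 0 < c) :
    ∃ D₀ : ℕ, ∀ D : ℕ, D₀ ≤ D → ∀ σ : ℝ, 0 ≤ σ →
      ∑ m ∈ Finset.Icc 2 D, (K * (m : ℝ) ^ 3 * σ) ^ m
        ≤ ∑ m ∈ Finset.Icc 1 D, (c * (m : ℝ) ^ 4 * σ) ^ m := by
  obtain ⟨m₀, hm₀⟩ := exists_nat_ge (2 * K / c)
  have hm₀' : 2 * K ≤ c * m₀ := by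
    rw [div_le_iff₀ hc] at hm₀; linarith
  set A : ℝ := ∑ m ∈ Finset.range m₀, (K * (m : ℝ) ^ 3) ^ m with hA
  have hA0 : 0 ≤ A := Finset.sum_nonneg fun _ _ => by positivity
  -- `ε` separates small from large `σ`; it is chosen so that `A * (ε * σ)` is at most the term `c *
  -- σ` of index one.
  set ε : ℝ := min 1 (c / (A + 1)) with hε
  have hε0 : 0 < ε := lt_min one_pos (by positivity)
  have hε1 : ε ≤ 1 := min_le_left _ _
  have hεA : A * ε ≤ c := by
    have h1 : ε ≤ c / (A + 1) := min_le_right _ _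
    rw [le_div_iff₀ (by positivity)] at h1
    nlinarith
  -- Beyond `D₁` one has `c ε D⁴ ≥ 2 A + 1`, so half of the top term dominates `A * (σ / ε)^D`.
  obtain ⟨D₁, hD₁⟩ := exists_nat_ge ((2 * A + 1) / (c * ε))
  refine ⟨max 2 D₁, fun D hD σ hσ => ?_⟩
  have hD2 : 2 ≤ D := le_of_max_le_left hD
  have hDD : (D₁ : ℝ) ≤ D := by exact_mod_cast le_of_max_le_right hD
  have hD1' : (1 : ℝ) ≤ D := by exact_mod_cast (by omega : 1 ≤ D)
  set t : ℕ → ℝ := fun m => (c * (m : ℝ) ^ 4 * σ) ^ m with ht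
  have ht0 : ∀ m, 0 ≤ t m := fun m => by simp only [ht]; positivity
  have hpow : ∀ m, 2 ≤ m → m ≤ D → σ ^ m ≤ ε * σ + (σ / ε) ^ D := by
    intro m h2 hm
    rcases le_total σ ε with h | h
    · have : σ ^ m ≤ ε * σ := by
        obtain ⟨k, rfl⟩ : ∃ k, m = k + 2 := ⟨m - 2, by omega⟩
        have h1 : σ ^ k ≤ 1 := pow_le_one₀ hσ (h.trans hε1)
        calc σ ^ (k + 2) = σ ^ k * (σ * σ) := by ring
          _ ≤ 1 * (ε * σ) := by gcongr
          _ = ε * σ := one_mul _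
      exact this.trans (le_add_of_nonneg_right (by positivity))
    · have h1 : 1 ≤ σ / ε := by rwa [le_div_iff₀ hε0, one_mul]
      have h2 : σ ≤ σ / ε := by
        rw [le_div_iff₀ hε0]
        exact mul_le_of_le_one_right hσ hε1
      calc σ ^ m ≤ (σ / ε) ^ m := by gcongr
        _ ≤ (σ / ε) ^ D := pow_le_pow_right₀ h1 hm
        _ ≤ _ := le_add_of_nonneg_left (by positivity)
  -- Only half of each `t m` is spent here; the other half of `t D` is kept for the terms with `m <
  -- m₀`.
  have hterm : ∀ m ∈ Finset.Icc 2 D, (K * (m : ℝ) ^ 3 * σ) ^ m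
      ≤ t m / 2 + if m ∈ Finset.range m₀ then
          (K * (m : ℝ) ^ 3) ^ m * (ε * σ + (σ / ε) ^ D) else 0 := by
    intro m hm
    obtain ⟨h2, hmD⟩ := Finset.mem_Icc.1 hm
    split_ifs with h
    · rw [mul_pow]
      have := mul_le_mul_of_nonneg_left (hpow m h2 hmD)
        (by positivity : 0 ≤ (K * (m : ℝ) ^ 3) ^ m)
      linarith [ht0 m]
    · have hmm : (m₀ : ℝ) ≤ m := by
        rw [Finset.mem_range, not_lt] at h; exact_mod_cast h
      have h3 : K * (m : ℝ) ^ 3 * σ ≤ c * (m : ℝ) ^ 4 * σ / 2 := by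
        have : 2 * K ≤ c * m := hm₀'.trans (by gcongr)
        have h4 : 0 ≤ (m : ℝ) ^ 3 * σ := by positivity
        nlinarith
      rw [add_zero]
      calc (K * (m : ℝ) ^ 3 * σ) ^ m ≤ (c * (m : ℝ) ^ 4 * σ / 2) ^ m := by gcongr
        _ = t m / 2 ^ m := div_pow _ _ _
        _ ≤ t m / 2 := by
            refine div_le_div_of_nonneg_left (ht0 m) two_pos ?_
            calc (2 : ℝ) = 2 ^ 1 := (pow_one _).symm
              _ ≤ 2 ^ m := pow_le_pow_right₀ one_le_two (by omega)
  have hsmall : ∑ m ∈ Finset.Icc 2 D, (if m ∈ Finset.range m₀ then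
      (K * (m : ℝ) ^ 3) ^ m * (ε * σ + (σ / ε) ^ D) else 0) ≤ A * (ε * σ + (σ / ε) ^ D) := by
    rw [Finset.sum_ite_mem, hA, Finset.sum_mul]
    exact Finset.sum_le_sum_of_subset_of_nonneg Finset.inter_subset_right
      fun m _ _ => by positivity
  have hD : A * (σ / ε) ^ D ≤ t D / 2 := by
    have h1 : 2 * A + 1 ≤ c * ε * D ^ 4 := by
      rw [div_le_iff₀ (by positivity)] at hD₁
      have h5 : (D : ℝ) ≤ (D : ℝ) ^ 4 := le_self_pow₀ hD1' (by norm_num)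
      calc 2 * A + 1 ≤ D₁ * (c * ε) := hD₁
        _ ≤ (D : ℝ) ^ 4 * (c * ε) := by gcongr; linarith
        _ = _ := by ring
    have h2 : 2 * A ≤ (c * ε * D ^ 4) ^ D :=
      (by linarith : 2 * A ≤ c * ε * D ^ 4).trans (le_self_pow₀ (by linarith) (by omega))
    have h3 : t D = (c * ε * D ^ 4) ^ D * (σ / ε) ^ D := by
      simp only [ht]
      rw [← mul_pow]
      congr 1
      field_simp
    rw [h3]
    have h4 : 0 ≤ (σ / ε) ^ D := by positivity
    nlinarith
  have h1 : A * (ε * σ) ≤ t 1 := by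
    simp only [ht]
    calc A * (ε * σ) = A * ε * σ := by ring
      _ ≤ c * σ := by gcongr
      _ = _ := by simp
  have htD : t D ≤ ∑ m ∈ Finset.Icc 2 D, t m :=
    Finset.single_le_sum (fun m _ => ht0 m) (Finset.mem_Icc.2 ⟨hD2, le_rfl⟩)
  have hsplit : ∑ m ∈ Finset.Icc 1 D, t m = t 1 + ∑ m ∈ Finset.Icc 2 D, t m := by
    rw [← Finset.add_sum_Ioc_eq_sum_Icc (by omega : 1 ≤ D)]
    rfl
  have hsum := Finset.sum_le_sum hterm
  rw [Finset.sum_add_distrib, ← Finset.sum_div] at hsum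
  rw [hsplit]
  linarith

/-- Without floors this is an equality, and rounding the exponents down only decreases powers of `n,
d ≥ 1`. The roots `ν` and `δ` turn the fractional exponents into natural ones. -/
theorem natCast_pow_mul_pow_div_le {n d : ℕ} (hn : 0 < n) (hd : 0 < d) (m : ℕ) :
    (n : ℝ) ^ (m / 4) * (d : ℝ) ^ (m / 2) / (d : ℝ) ^ m
      ≤ (((n : ℝ) / (d : ℝ) ^ 2) ^ (4⁻¹ : ℝ)) ^ m := by
  have hn1 : (1 : ℝ) ≤ n := by exact_mod_cast hn
  have hd1 : (1 : ℝ) ≤ d := by exact_mod_cast hd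
  set ν : ℝ := (n : ℝ) ^ (4⁻¹ : ℝ) with hν
  set δ : ℝ := (d : ℝ) ^ (2⁻¹ : ℝ) with hδ
  have hν1 : 1 ≤ ν := Real.one_le_rpow hn1 (by norm_num)
  have hδ1 : 1 ≤ δ := Real.one_le_rpow hd1 (by norm_num)
  have hν4 : ν ^ 4 = n := by
    rw [hν, ← Real.rpow_natCast, ← Real.rpow_mul (by positivity)]; norm_num
  have hδ2 : δ ^ 2 = d := by
    rw [hδ, ← Real.rpow_natCast, ← Real.rpow_mul (by positivity)]; norm_num
  have hσ : ((n : ℝ) / (d : ℝ) ^ 2) ^ (4⁻¹ : ℝ) = ν / δ := by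
    rw [Real.div_rpow (by positivity) (by positivity), ← hν, hδ, ← Real.rpow_natCast,
      ← Real.rpow_mul (by positivity)]
    norm_num
  rw [hσ, ← hν4, ← hδ2, ← pow_mul, ← pow_mul, ← pow_mul, div_pow, div_le_div_iff₀ (by positivity)
    (by positivity)]
  calc ν ^ (4 * (m / 4)) * δ ^ (2 * (m / 2)) * δ ^ m ≤ ν ^ m * δ ^ m * δ ^ m := by
        gcongr
        · omega
        · omega
    _ = ν ^ m * δ ^ (2 * m) := by ring

/-! ### Bounds in the low-degree regime -/

section Regime

variable {β : ℝ} {p : Measure ℝ} [IsProbabilityMeasure p] {Λ : ℝ}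

/-- The single term of degree `4q` suffices: the factor `24^q` in the sign moment cancels the one in
the row weights, and `C(n, q) ≥ (n / q)^q`. -/
theorem lower_bound_top_degree (hβ : 0 < β) (hp : LatentAssumption p Λ) {n d D : ℕ}
    (hD : 10 ≤ D / 4) (hd : 2 * (D / 4) ≤ d) (hn : D / 4 ≤ n) :
    (1 / ((D / 4 : ℕ) : ℝ) * (β ^ 2 * kappa4 p / (1 + β) ^ 2) ^ 2
        * ((n : ℝ) / (d : ℝ) ^ 2)) ^ (D / 4)
      ≤ ldlrNorm β p n d D ^ 2 := by
  set q := D / 4 with hq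
  have hd0 : 0 < d := by omega
  have hd' : (0 : ℝ) < d := by exact_mod_cast hd0
  have hq' : (0 : ℝ) < q := by exact_mod_cast (by omega : 0 < q)
  refine le_trans ?_ (degreeTerm_le_norm_sq hβ hp n hd0 (by omega : 4 * q ≤ D))
  have hB : 24 ^ q * (d : ℝ) ^ (2 * q)
      ≤ ∫ u, (∑ i, u i) ^ (4 * q) ∂(Measure.pi fun _ : Fin d => rademacher) := by
    refine (pow_le_choose_mul_factorial hD hd).trans ?_
    have := choose_mul_le_integral_pow_sum d (2 * q)
    rwa [← mul_assoc] at this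
  refine le_trans ?_ (degreeTerm_four_mul_ge hβ hp n d q hB)
  calc (1 / (q : ℝ) * (β ^ 2 * kappa4 p / (1 + β) ^ 2) ^ 2 * ((n : ℝ) / (d : ℝ) ^ 2)) ^ q
      = 24 ^ q * (d : ℝ) ^ (2 * q) / (d : ℝ) ^ (4 * q)
        * (((n : ℝ) / q) ^ q * ((β / (1 + β)) ^ 4 * kappa4 p ^ 2 / 24) ^ q) := by
        rw [pow_mul, pow_mul, ← mul_pow, ← mul_pow, ← div_pow, ← mul_pow]
        congr 1
        field_simp
    _ ≤ _ := by
        gcongr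
        exact div_pow_le_choose hn

/-- The constant in the crude bound on the degree `m` contributions. -/
def growthConst (β : ℝ) (p : Measure ℝ) : ℝ :=
  2 * (∫ x, Real.exp (x ^ 2 / 2) ∂p) ^ 2 * (β / (1 + β))

theorem one_le_sq_integral_exp (hp : LatentAssumption p Λ) :
    1 ≤ (∫ x, Real.exp (x ^ 2 / 2) ∂p) ^ 2 := by
  simpa [hermiteCoeff_zero] using sq_hermiteCoeff_le hp.exp_integrable 0

theorem growthConst_pos (hβ : 0 < β) (hp : LatentAssumption p Λ) : 0 < growthConst β p := by
  have := one_le_sq_integral_exp hp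
  unfold growthConst
  positivity

/-- Each nonzero row costs a factor `E ≥ 1`, absorbed into `E^{k i}`; zero rows cost nothing, so the
bound does not depend on their number. -/
theorem prod_sq_hermiteCoeff_le (hp : LatentAssumption p Λ) {ι : Type*} [Fintype ι] {m : ℕ}
    (k : ι → ℕ) (hk : ∑ i, k i = m) :
    ∏ i, hermiteCoeff p (k i) ^ 2 ≤ (2 * (∫ x, Real.exp (x ^ 2 / 2) ∂p) ^ 2 * m) ^ m := by
  have hE := one_le_sq_integral_exp hp
  set E := (∫ x, Real.exp (x ^ 2 / 2) ∂p) ^ 2 with hE'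
  calc ∏ i, hermiteCoeff p (k i) ^ 2 ≤ ∏ i, (2 * E * m) ^ k i := by
        refine Finset.prod_le_prod (fun _ _ => sq_nonneg _) fun i _ => ?_
        rcases Nat.eq_zero_or_pos (k i) with h0 | hpos
        · simp [h0, hermiteCoeff_zero]
        have hle : (k i : ℝ) ≤ m := by
          rw [← hk]
          exact_mod_cast Finset.single_le_sum (f := k) (fun _ _ => zero_le) (Finset.mem_univ i)
        calc hermiteCoeff p (k i) ^ 2 ≤ (2 * k i) ^ k i * E :=
              sq_hermiteCoeff_le hp.exp_integrable _
          _ ≤ (2 * k i) ^ k i * E ^ k i := by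
              gcongr
              exact le_self_pow₀ hE hpos.ne'
          _ = (2 * E * k i) ^ k i := by rw [← mul_pow]; ring
          _ ≤ (2 * E * m) ^ k i := by gcongr
    _ = _ := by rw [Finset.prod_pow_eq_pow_sum, hk]

/-- Of the power `m³`, one factor comes from the Hermite coefficients and two from the counting
factor `(⌊m/4⌋ ⌊m/2⌋)^m`; the remaining `1 / m!` is discarded. -/
theorem degreeTerm_le_pow (hβ : 0 < β) (hp : LatentAssumption p Λ) {n d m : ℕ} (hn0 : 0 < n)
    (hd0 : 0 < d) (hn : m / 4 ≤ n) (hd : m / 2 ≤ d) :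
    degreeTerm β p n d m
      ≤ (growthConst β p * (m : ℝ) ^ 3 * ((n : ℝ) / (d : ℝ) ^ 2) ^ (4⁻¹ : ℝ)) ^ m := by
  set E := (∫ x, Real.exp (x ^ 2 / 2) ∂p) ^ 2 with hE'
  have hE : 0 ≤ E := sq_nonneg _
  refine (degreeTerm_le hβ hp hn hd (S := (2 * E * m) ^ m) (by positivity)
    fun k hk => prod_sq_hermiteCoeff_le hp k hk).trans ?_
  have h1 : (n.choose (m / 4) : ℝ) ≤ (n : ℝ) ^ (m / 4) := by
    exact_mod_cast Nat.choose_le_pow n (m / 4)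
  have h2 : (d.choose (m / 2) : ℝ) ≤ (d : ℝ) ^ (m / 2) := by
    exact_mod_cast Nat.choose_le_pow d (m / 2)
  have h3 : ((m / 4 * (m / 2) : ℕ) : ℝ) ^ m / (m.factorial : ℝ) ≤ ((m : ℝ) ^ 2) ^ m := by
    refine (div_le_self (by positivity) (by exact_mod_cast m.factorial_pos)).trans ?_
    gcongr
    rw [pow_two]
    exact_mod_cast Nat.mul_le_mul (Nat.div_le_self m 4) (Nat.div_le_self m 2)
  have h4 := natCast_pow_mul_pow_div_le hn0 hd0 m
  calc (β / (1 + β)) ^ m / (d : ℝ) ^ m * (2 * E * m) ^ m * n.choose (m / 4) * d.choose (m / 2)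
        * ((m / 4 * (m / 2) : ℕ) ^ m / (m.factorial : ℝ))
      ≤ (β / (1 + β)) ^ m / (d : ℝ) ^ m * (2 * E * m) ^ m * (n : ℝ) ^ (m / 4) * (d : ℝ) ^ (m / 2)
        * ((m : ℝ) ^ 2) ^ m := by gcongr
    _ = (growthConst β p * (m : ℝ) ^ 3) ^ m
        * ((n : ℝ) ^ (m / 4) * (d : ℝ) ^ (m / 2) / (d : ℝ) ^ m) := by
        have : growthConst β p * (m : ℝ) ^ 3 = (β / (1 + β)) * (2 * E * m) * (m : ℝ) ^ 2 := by
          rw [growthConst, ← hE']; ring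
        rw [this, mul_pow, mul_pow]
        ring
    _ ≤ (growthConst β p * (m : ℝ) ^ 3) ^ m * (((n : ℝ) / (d : ℝ) ^ 2) ^ (4⁻¹ : ℝ)) ^ m := by
        have := (growthConst_pos hβ hp).le
        gcongr
    _ = _ := (mul_pow _ _ _).symm

/-- Since `⌊1/4⌋ = 0`, no row can be active. This frees the linear term on the right of
`exists_sum_le_sum`. -/
theorem degreeTerm_one (hβ : 0 < β) (hp : LatentAssumption p Λ) (n d : ℕ) :
    degreeTerm β p n d 1 ≤ 0 := by
  refine (degreeTerm_le hβ hp (by simp) (by simp) (m := 1) (S := 1 * _) ?_ fun k hk => by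
    rw [one_mul]; exact prod_sq_hermiteCoeff_le hp k hk).trans ?_
  · positivity
  · simp

theorem exists_upper_bound (hβ : 0 < β) (hp : LatentAssumption p Λ) :
    ∃ D₀ : ℕ, ∀ n d D : ℕ, D₀ ≤ D → 0 < n → 0 < d → D / 4 ≤ n → D / 2 ≤ d →
      ldlrNorm β p n d D ^ 2 ≤ 1 + ∑ m ∈ Finset.Icc 1 D,
        (Λ ^ 2 * β / (1 + β) * (m : ℝ) ^ 4 * ((n : ℝ) / (d : ℝ) ^ 2) ^ (4⁻¹ : ℝ)) ^ m := by
  have hΛ := hp.const_pos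
  obtain ⟨D₀, hD₀⟩ := exists_sum_le_sum (growthConst_pos hβ hp)
    (by positivity : 0 < Λ ^ 2 * β / (1 + β))
  refine ⟨max 1 D₀, fun n d D hD hn hd hnD hdD => ?_⟩
  have hD1 : 1 ≤ D := le_of_max_le_left hD
  rw [norm_sq_eq_one_add hβ hp n hd]
  refine add_le_add_right (le_trans ?_ (hD₀ D (le_of_max_le_right hD)
    (((n : ℝ) / (d : ℝ) ^ 2) ^ (4⁻¹ : ℝ)) (by positivity))) 1
  rw [← Finset.add_sum_Ioc_eq_sum_Icc hD1]
  refine (add_le_of_nonpos_left (degreeTerm_one hβ hp n d)).trans ?_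
  refine Finset.sum_le_sum fun m hm => ?_
  have := Finset.mem_Ioc.1 hm
  exact degreeTerm_le_pow hβ hp hn hd (by omega) (by omega)

end Regime

/-! ### Asymptotics -/

section Asymptotics

variable {ε θ : ℝ} {D n d : ℕ → ℕ}

theorem tendsto_degree_atTop (hε : 0 < ε)
    (hD : (fun N : ℕ => (D N : ℝ)) =Θ[atTop] (fun N : ℕ => Real.log (N : ℝ) ^ (1 + ε))) :
    Tendsto D atTop atTop := by
  have h : Tendsto (fun N : ℕ => Real.log (N : ℝ) ^ (1 + ε)) atTop atTop :=
    (tendsto_rpow_atTop (by linarith)).comp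
      (Real.tendsto_log_atTop.comp tendsto_natCast_atTop_atTop)
  have h2 := hD.tendsto_norm_atTop_iff.2 (tendsto_norm_atTop_atTop.comp h)
  have h3 : Tendsto (fun N => (D N : ℝ)) atTop atTop := by
    simpa [Function.comp_def] using h2
  exact tendsto_natCast_atTop_iff.1 h3

theorem degree_isLittleO
    (hD : (fun N : ℕ => (D N : ℝ)) =Θ[atTop] (fun N : ℕ => Real.log (N : ℝ) ^ (1 + ε)))
    (hn : Tendsto n atTop atTop) {s : ℝ} (hs : 0 < s) :
    (fun j => (D (n j) : ℝ)) =o[atTop] (fun j => (n j : ℝ) ^ s) := by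
  have h := (isLittleO_log_rpow_rpow_atTop (1 + ε) hs).comp_tendsto
    (tendsto_natCast_atTop_atTop (R := ℝ))
  exact (hD.1.trans_isLittleO h).comp_tendsto hn

theorem rpow_isBigO_of_isTheta
    (h : (fun j : ℕ => (n j : ℝ)) =Θ[atTop] (fun j : ℕ => (d j : ℝ) ^ θ)) {s : ℝ} (hs : 0 ≤ s) :
    (fun j => (n j : ℝ) ^ s) =O[atTop] (fun j => (d j : ℝ) ^ (θ * s)) := by
  refine (h.1.rpow hs (.of_forall fun j => by simp only [Pi.zero_apply]; positivity)).congr_right fun j => ?_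
  rw [Real.rpow_mul (by positivity)]

theorem rpow_isBigO_of_isTheta' (hθ : 0 < θ)
    (h : (fun j : ℕ => (n j : ℝ)) =Θ[atTop] (fun j : ℕ => (d j : ℝ) ^ θ)) {s : ℝ} (hs : 0 ≤ s) :
    (fun j => (d j : ℝ) ^ s) =O[atTop] (fun j => (n j : ℝ) ^ (s / θ)) := by
  have h1 := h.2.rpow (r := s / θ) (by positivity)
    (.of_forall fun j => by simp only [Pi.zero_apply]; positivity)
  refine h1.congr_left fun j => ?_
  rw [← Real.rpow_mul (by positivity), mul_div_cancel₀ _ hθ.ne']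

theorem eventually_le_dimensions (hθ : 0 < θ)
    (hD : (fun N : ℕ => (D N : ℝ)) =Θ[atTop] (fun N : ℕ => Real.log (N : ℝ) ^ (1 + ε)))
    (hn : Tendsto n atTop atTop)
    (h : (fun j : ℕ => (n j : ℝ)) =Θ[atTop] (fun j : ℕ => (d j : ℝ) ^ θ)) :
    ∀ᶠ j in atTop, D (n j) ≤ n j ∧ D (n j) ≤ d j := by
  have h1 := (degree_isLittleO hD hn one_pos).def one_pos
  have h2 := ((degree_isLittleO hD hn (s := θ⁻¹) (by positivity)).trans_isBigO
    (rpow_isBigO_of_isTheta h (by positivity))).def one_pos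
  filter_upwards [h1, h2] with j h1 h2
  rw [mul_inv_cancel₀ hθ.ne'] at h2
  simp only [Real.rpow_one, one_mul, Real.norm_natCast, Nat.cast_le] at h1 h2
  exact ⟨h1, h2⟩

/-- Below the critical scaling `n ≍ d²`, `D ^ 4 * (n / d²) ^ (1 / 4)` tends to zero. -/
theorem tendsto_degree_pow_mul (hθ : 0 < θ) (hθ2 : θ < 2)
    (hD : (fun N : ℕ => (D N : ℝ)) =Θ[atTop] (fun N : ℕ => Real.log (N : ℝ) ^ (1 + ε)))
    (hn : Tendsto n atTop atTop)
    (h : (fun j : ℕ => (n j : ℝ)) =Θ[atTop] (fun j : ℕ => (d j : ℝ) ^ θ)) :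
    Tendsto (fun j => (D (n j) : ℝ) ^ 4 * ((n j : ℝ) / (d j : ℝ) ^ 2) ^ (4⁻¹ : ℝ)) atTop (𝓝 0) := by
  -- Chosen so that `n^{1 + s}` has the order of `d²`. As `D^16 = o(n^s)`, this gives `D^16 n =
  -- o(d²)`, and the claim is its fourth root.
  set s : ℝ := 2 / θ - 1 with hs
  have hs0 : 0 < s := by
    rw [hs, sub_pos, lt_div_iff₀ hθ]; linarith
  have h1 : (fun j => (D (n j) : ℝ) ^ 16 * (n j : ℝ)) =o[atTop] fun j => (d j : ℝ) ^ 2 := by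
    have h2 := ((degree_isLittleO hD hn (s := s / 16) (by positivity)).pow (n := 16)
      (by norm_num)).mul_isBigO (Asymptotics.isBigO_refl (fun j => (n j : ℝ)) atTop)
    have h3 := rpow_isBigO_of_isTheta h (s := s + 1) (by positivity)
    have e1 : θ * (s + 1) = 2 := by rw [hs]; field_simp; ring
    rw [e1] at h3
    have h4 : (fun j => ((n j : ℝ) ^ (s / 16)) ^ 16 * (n j : ℝ))
        =ᶠ[atTop] fun j => (n j : ℝ) ^ (s + 1) := by
      filter_upwards [hn.eventually_gt_atTop 0] with j hj
      have hj' : (0 : ℝ) < n j := by exact_mod_cast hj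
      rw [← Real.rpow_natCast, ← Real.rpow_mul hj'.le, Real.rpow_add_one hj'.ne']
      norm_num
    have h5 := (h2.trans_eventuallyEq h4).trans_isBigO h3
    exact h5.congr_right fun j => by norm_num
  have h6 := (h1.tendsto_div_nhds_zero.rpow_const (p := (4⁻¹ : ℝ)) (Or.inr (by norm_num)))
  rw [Real.zero_rpow (by norm_num)] at h6
  refine h6.congr fun j => ?_
  rw [mul_div_assoc, Real.mul_rpow (by positivity) (by positivity), ← Real.rpow_natCast,
    ← Real.rpow_mul (by positivity), ← Real.rpow_natCast]
  norm_num

/-- Above the critical scaling `n ≍ d²`, `n / d²` dominates the degree `D`. -/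
theorem tendsto_ratio_div_degree (hθ2 : 2 < θ) (hε : 0 < ε)
    (hD : (fun N : ℕ => (D N : ℝ)) =Θ[atTop] (fun N : ℕ => Real.log (N : ℝ) ^ (1 + ε)))
    (hn : Tendsto n atTop atTop) (hd : Tendsto d atTop atTop)
    (h : (fun j : ℕ => (n j : ℝ)) =Θ[atTop] (fun j : ℕ => (d j : ℝ) ^ θ)) :
    Tendsto (fun j => (n j : ℝ) / ((D (n j) : ℝ) * (d j : ℝ) ^ 2)) atTop atTop := by
  have hθ : 0 < θ := by linarith
  have hs0 : 0 < 1 - 2 / θ := by rw [sub_pos, div_lt_one hθ]; exact hθ2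
  -- `D = o(n^{1 - 2/θ})` and `d² = O(n^{2/θ})` give `D d² = o(n)`; the reciprocal then diverges
  -- because the quantities are eventually positive.
  have h1 := (degree_isLittleO hD hn hs0).mul_isBigO
    (rpow_isBigO_of_isTheta' hθ h (s := 2) (by norm_num))
  have h4 : (fun j => (n j : ℝ) ^ (1 - 2 / θ) * (n j : ℝ) ^ (2 / θ))
      =ᶠ[atTop] fun j => (n j : ℝ) := by
    filter_upwards [hn.eventually_gt_atTop 0] with j hj
    have hj' : (0 : ℝ) < n j := by exact_mod_cast hj
    rw [← Real.rpow_add hj']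
    norm_num
  have h5 := (h1.trans_eventuallyEq h4).tendsto_div_nhds_zero
  have hDt := (tendsto_degree_atTop hε hD).comp hn
  have h6 : Tendsto (fun j => (D (n j) : ℝ) * (d j : ℝ) ^ (2 : ℝ) / (n j : ℝ)) atTop (𝓝[>] 0) := by
    refine tendsto_nhdsWithin_iff.2 ⟨h5, ?_⟩
    filter_upwards [hn.eventually_gt_atTop 0, hd.eventually_gt_atTop 0,
      hDt.eventually_gt_atTop 0] with j h1 h2 h3
    simp only [Function.comp] at h3
    have h1' : (0 : ℝ) < n j := by exact_mod_cast h1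
    have h2' : (0 : ℝ) < d j := by exact_mod_cast h2
    have h3' : (0 : ℝ) < D (n j) := by exact_mod_cast h3
    simp only [Set.mem_Ioi]
    positivity
  refine h6.inv_tendsto_nhdsGT_zero.congr fun j => ?_
  simp only [Pi.inv_apply]
  rw [inv_div]
  norm_num

end Asymptotics

section Limits

variable {β : ℝ} {p : Measure ℝ} [IsProbabilityMeasure p] {Λ ε θ : ℝ} {D n d : ℕ → ℕ}

omit [IsProbabilityMeasure p] in
theorem ldlrNorm_nonneg (n d D : ℕ) : 0 ≤ ldlrNorm β p n d D := norm_nonneg _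

theorem eventually_lower_bound (hβ : 0 < β) (hp : LatentAssumption p Λ) (hε : 0 < ε) (hθ : 0 < θ)
    (hD : (fun N : ℕ => (D N : ℝ)) =Θ[atTop] (fun N : ℕ => Real.log (N : ℝ) ^ (1 + ε)))
    (hn : Tendsto n atTop atTop)
    (h : (fun j : ℕ => (n j : ℝ)) =Θ[atTop] (fun j : ℕ => (d j : ℝ) ^ θ)) :
    ∀ᶠ j in atTop,
      (1 / ((D (n j) / 4 : ℕ) : ℝ) * (β ^ 2 * kappa4 p / (1 + β) ^ 2) ^ 2 *
          ((n j : ℝ) / (d j : ℝ) ^ 2)) ^ (D (n j) / 4)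
        ≤ ldlrNorm β p (n j) (d j) (D (n j)) ^ 2 := by
  -- The threshold 40 ensures `D / 4 ≥ 10`, as `lower_bound_top_degree` requires.
  filter_upwards [eventually_le_dimensions hθ hD hn h,
    ((tendsto_degree_atTop hε hD).comp hn).eventually_ge_atTop 40] with j h1 h2
  simp only [Function.comp] at h2
  exact lower_bound_top_degree hβ hp (by omega) (by omega) (by omega)

theorem eventually_upper_bound (hβ : 0 < β) (hp : LatentAssumption p Λ) (hε : 0 < ε) (hθ : 0 < θ)
    (hD : (fun N : ℕ => (D N : ℝ)) =Θ[atTop] (fun N : ℕ => Real.log (N : ℝ) ^ (1 + ε)))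
    (hn : Tendsto n atTop atTop) (hd : Tendsto d atTop atTop)
    (h : (fun j : ℕ => (n j : ℝ)) =Θ[atTop] (fun j : ℕ => (d j : ℝ) ^ θ)) :
    ∀ᶠ j in atTop, ldlrNorm β p (n j) (d j) (D (n j)) ^ 2 ≤ 1 + ∑ m ∈ Finset.Icc 1 (D (n j)),
      (Λ ^ 2 * β / (1 + β) * (m : ℝ) ^ 4 * ((n j : ℝ) / (d j : ℝ) ^ 2) ^ (4⁻¹ : ℝ)) ^ m := by
  obtain ⟨D₀, hD₀⟩ := exists_upper_bound hβ hp
  filter_upwards [eventually_le_dimensions hθ hD hn h, hn.eventually_gt_atTop 0,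
    hd.eventually_gt_atTop 0,
    ((tendsto_degree_atTop hε hD).comp hn).eventually_ge_atTop D₀] with j h1 h2 h3 h4
  exact hD₀ _ _ _ h4 h2 h3 (by omega) (by omega)

/-- Squeeze the squared norm. The degree zero term gives at least one; since `m ≤ D`, the upper sum
is bounded by a geometric series in `x = c D⁴ (n / d²)^{1/4}`, which tends to zero. -/
theorem tendsto_norm_one (hβ : 0 < β) (hp : LatentAssumption p Λ) (hε : 0 < ε) (hθ : 0 < θ)
    (hθ2 : θ < 2)
    (hD : (fun N : ℕ => (D N : ℝ)) =Θ[atTop] (fun N : ℕ => Real.log (N : ℝ) ^ (1 + ε)))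
    (hn : Tendsto n atTop atTop) (hd : Tendsto d atTop atTop)
    (h : (fun j : ℕ => (n j : ℝ)) =Θ[atTop] (fun j : ℕ => (d j : ℝ) ^ θ)) :
    Tendsto (fun j => ldlrNorm β p (n j) (d j) (D (n j))) atTop (𝓝 1) := by
  set c := Λ ^ 2 * β / (1 + β) with hc
  have hc0 : 0 < c := by have := hp.const_pos; positivity
  set x : ℕ → ℝ := fun j => c * ((D (n j) : ℝ) ^ 4 * ((n j : ℝ) / (d j : ℝ) ^ 2) ^ (4⁻¹ : ℝ)) with hx
  have hx0 : Tendsto x atTop (𝓝 0) := by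
    simpa using (tendsto_degree_pow_mul hθ hθ2 hD hn h).const_mul c
  have hsq : Tendsto (fun j => ldlrNorm β p (n j) (d j) (D (n j)) ^ 2) atTop (𝓝 1) := by
    have hup : Tendsto (fun j => 1 + 2 * x j) atTop (𝓝 1) := by
      simpa using (hx0.const_mul 2).const_add 1
    refine tendsto_of_tendsto_of_tendsto_of_le_of_le' tendsto_const_nhds hup ?_ ?_
    · filter_upwards [hd.eventually_gt_atTop 0] with j hj
      exact one_le_norm_sq hβ hp _ hj _
    · filter_upwards [eventually_upper_bound hβ hp hε hθ hD hn hd h,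
        hx0.eventually_le_const (by norm_num : (0 : ℝ) < 2⁻¹)] with j h1 h2
      refine h1.trans (add_le_add_right ?_ 1)
      have hxj : 0 ≤ x j := by simp only [hx]; positivity
      calc ∑ m ∈ Finset.Icc 1 (D (n j)),
            (c * (m : ℝ) ^ 4 * ((n j : ℝ) / (d j : ℝ) ^ 2) ^ (4⁻¹ : ℝ)) ^ m
          ≤ ∑ m ∈ Finset.Icc 1 (D (n j)), x j ^ m := by
            refine Finset.sum_le_sum fun m hm => ?_
            have hm' : (m : ℝ) ≤ D (n j) := by exact_mod_cast (Finset.mem_Icc.1 hm).2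
            simp only [hx, ← mul_assoc]
            gcongr
        _ = ∑ m ∈ Finset.Ico 1 (D (n j) + 1), x j ^ m := rfl
        _ ≤ x j ^ 1 / (1 - x j) := geom_sum_Ico_le_of_lt_one hxj (by linarith)
        _ ≤ 2 * x j := by
            rw [pow_one, div_le_iff₀ (by linarith)]
            nlinarith
  have := hsq.sqrt
  rw [Real.sqrt_one] at this
  exact this.congr fun j => Real.sqrt_sq (ldlrNorm_nonneg _ _ _)

/-- As `⌊D/4⌋ ≤ D`, the base of the power in the lower bound is at least a positive multiple of `n /
(D d²)`, which diverges. Once the base exceeds one, the power is at least the base. -/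
theorem tendsto_norm_atTop_of_kappa4 (hβ : 0 < β) (hp : LatentAssumption p Λ) (hε : 0 < ε)
    (hθ2 : 2 < θ)
    (hκ : kappa4 p ≠ 0)
    (hD : (fun N : ℕ => (D N : ℝ)) =Θ[atTop] (fun N : ℕ => Real.log (N : ℝ) ^ (1 + ε)))
    (hn : Tendsto n atTop atTop) (hd : Tendsto d atTop atTop)
    (h : (fun j : ℕ => (n j : ℝ)) =Θ[atTop] (fun j : ℕ => (d j : ℝ) ^ θ)) :
    Tendsto (fun j => ldlrNorm β p (n j) (d j) (D (n j))) atTop atTop := by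
  have hθ : 0 < θ := by linarith
  set κ : ℝ := (β ^ 2 * kappa4 p / (1 + β) ^ 2) ^ 2 with hκdef
  have hκ0 : 0 < κ := by positivity
  have hb : Tendsto (fun j => κ * ((n j : ℝ) / ((D (n j) : ℝ) * (d j : ℝ) ^ 2))) atTop atTop :=
    (tendsto_ratio_div_degree hθ2 hε hD hn hd h).const_mul_atTop hκ0
  have hsq : Tendsto (fun j => ldlrNorm β p (n j) (d j) (D (n j)) ^ 2) atTop atTop := by
    refine tendsto_atTop_mono' _ ?_ hb
    filter_upwards [eventually_lower_bound hβ hp hε hθ hD hn h, hb.eventually_ge_atTop 1,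
      hd.eventually_gt_atTop 0,
      ((tendsto_degree_atTop hε hD).comp hn).eventually_ge_atTop 4] with j h1 h2 h3 h4
    simp only [Function.comp] at h4
    refine le_trans ?_ h1
    have hq : 1 ≤ D (n j) / 4 := by omega
    have hq' : (0 : ℝ) < (D (n j) / 4 : ℕ) := by exact_mod_cast hq
    have hqD : ((D (n j) / 4 : ℕ) : ℝ) ≤ D (n j) := by exact_mod_cast Nat.div_le_self _ _
    have hd' : (0 : ℝ) < d j := by exact_mod_cast h3
    have h5 : κ * ((n j : ℝ) / ((D (n j) : ℝ) * (d j : ℝ) ^ 2))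
        ≤ 1 / ((D (n j) / 4 : ℕ) : ℝ) * κ * ((n j : ℝ) / (d j : ℝ) ^ 2) := by
      have e : 1 / ((D (n j) / 4 : ℕ) : ℝ) * κ * ((n j : ℝ) / (d j : ℝ) ^ 2)
          = κ * ((n j : ℝ) / (((D (n j) / 4 : ℕ) : ℝ) * (d j : ℝ) ^ 2)) := by
        field_simp
      rw [e]
      gcongr
    exact h5.trans (le_self_pow₀ (h2.trans h5) (by omega))
  exact (Real.tendsto_sqrt_atTop.comp hsq).congr fun j => Real.sqrt_sq (ldlrNorm_nonneg _ _ _)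

end Limits

end SpikedCumulant

end

/-! ### Assembly of the theorem -/

open SpikedCumulant in
theorem theorem2 (β : ℝ) (hβ : 0 < β) (p : Measure ℝ) [IsProbabilityMeasure p] (Λ : ℝ)
    (hp : LatentAssumption p Λ) :
    -- the likelihood ratio exists and is square integrable
    (∀ n d : ℕ, 0 < d →
      spikedMeasure β p n d ≪ nullMeasure n d ∧
      MemLp (likelihoodRatio (spikedMeasure β p n d) (nullMeasure n d)) 2 (nullMeasure n d)) ∧
    -- lower bound
    (∀ n d D : ℕ, 0 < d →
      ∑ m ∈ Finset.range (D / 4 + 1), (n.choose m : ℝ) * ((d + 1).choose 2 : ℝ) ^ m *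
          (β ^ 2 * kappa4 p / (√24 * (d : ℝ) ^ 2 * (1 + β) ^ 2)) ^ (2 * m)
        ≤ ldlrNorm β p n d D ^ 2) ∧
    -- upper bound
    (∀ n d D : ℕ, 0 < d → D / 4 ≤ n → D / 2 ≤ d →
      ldlrNorm β p n d D ^ 2 ≤
        1 + ∑ m ∈ Finset.Icc 1 D, upperCoeff β m / (d : ℝ) ^ m * hermiteSup p m *
          (n.choose (m / 4) : ℝ) * (d.choose (m / 2) : ℝ)) ∧
    -- asymptotics along any sequence `(n j, d j)` in the stated scaling
    (∀ ε θ : ℝ, 0 < ε → ε < 1 → 0 < θ → ∀ D n d : ℕ → ℕ,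
      (fun N : ℕ => (D N : ℝ)) =Θ[atTop] (fun N : ℕ => Real.log (N : ℝ) ^ (1 + ε)) →
      Tendsto n atTop atTop → Tendsto d atTop atTop →
      (fun j : ℕ => (n j : ℝ)) =Θ[atTop] (fun j : ℕ => (d j : ℝ) ^ θ) →
      (∀ᶠ j in atTop,
        (1 / ((D (n j) / 4 : ℕ) : ℝ) * (β ^ 2 * kappa4 p / (1 + β) ^ 2) ^ 2 *
            ((n j : ℝ) / (d j : ℝ) ^ 2)) ^ (D (n j) / 4)
          ≤ ldlrNorm β p (n j) (d j) (D (n j)) ^ 2) ∧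
      (∀ᶠ j in atTop,
        ldlrNorm β p (n j) (d j) (D (n j)) ^ 2 ≤
          1 + ∑ m ∈ Finset.Icc 1 (D (n j)), (Λ ^ 2 * β / (1 + β)) ^ m * (m : ℝ) ^ (4 * m) *
            ((n j : ℝ) / (d j : ℝ) ^ 2) ^ ((m : ℝ) / 4)) ∧
      (θ < 2 → Tendsto (fun j => ldlrNorm β p (n j) (d j) (D (n j))) atTop (𝓝 1)) ∧
      (2 < θ → kappa4 p ≠ 0 →
        Tendsto (fun j => ldlrNorm β p (n j) (d j) (D (n j))) atTop atTop)) := by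
  refine ⟨fun n d hd => ?_, fun n d D hd => lower_bound hβ hp n hd D,
    fun n d D hd hnD hdD => upper_bound hβ hp hd hnD hdD, ?_⟩
  · obtain ⟨C, hC, hle⟩ := spikedMeasure_le hβ hp.exp_integrable n hd
    exact ⟨absolutelyContinuous_of_le_smul hle, memLp_likelihoodRatio hC hle⟩
  · intro ε θ hε _ hθ D n d hD hn hd h
    refine ⟨eventually_lower_bound hβ hp hε hθ hD hn h, ?_,
      fun hθ2 => tendsto_norm_one hβ hp hε hθ hθ2 hD hn hd h,
      fun hθ2 hκ => tendsto_norm_atTop_of_kappa4 hβ hp hε hθ2 hκ hD hn hd h⟩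
    filter_upwards [eventually_upper_bound hβ hp hε hθ hD hn hd h] with j hj
    refine hj.trans_eq ?_
    congr 1
    refine Finset.sum_congr rfl fun m _ => ?_
    rw [mul_pow, mul_pow, ← pow_mul, ← Real.rpow_natCast (_ ^ (4⁻¹ : ℝ)),
      ← Real.rpow_mul (by positivity), inv_mul_eq_div]
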